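/- Proposition 5.3. Let $V$ be a simple vertex operator algebra over $\mathbb C$ with Virasoro element $\omega\neq 0$ (so $V=\bigoplus_{n\in\mathbb Z}V_n$ with $\dim V_n<\infty$ and $V_n=0$ for $n\ll 0$), and let $g$ be an automorphism of $V$ of finite order $T$. Put $V^0=\{v\in V\mid gv=v\}$. Let $M=\bigoplus_{n\ge 0}M(n/T)$ be an admissible $g$-twisted $V$-module with $M(0)\neq 0$, that is, a weak $g$-twisted $V$-module, with modes $v_m$ given by $Y_M(v,z)=\sum_{m\in\mathbb Q}v_mz^{-m-1}$ (where only $m\in r/T+\mathbb Z$ occur if $gv=e^{-2\pi i r/T}v$), such that $v_mM(n/T)\subseteq M(n/T+\mathrm{wt}\,v-m-1)$ for every homogeneous $v\in V$ (where $M(q)=0$ if $q\notin\frac1T\mathbb Z_{\ge 0}$). For homogeneous $v$ let $o(v)=v_{\mathrm{wt}\,v-1}$ on $M$, and extend $o$ linearly to $V$. Let $J_M(V^0)=\{v\in V^0\mid o(v)=0 \text{ on } M\}$, and let $S_M(V^0)=V^0/J_M(V^0)$ be the Lie algebra whose bracket is induced by $[a,b]=\sum_{i\ge 0}\binom{\mathrm{wt}\,a-1}{i}a_ib$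 for homogeneous $a\in V^0$ and $b\in V^0$; it acts on each $M(n/T)$ by $v\mapsto o(v)$. Then $M$ is irreducible (its only subspaces stable under all $v_m$, $v\in V$, $m\in\mathbb Q$, are $0$ and $M$) if and only if, for each $n\ge 0$, the space $M(n/T)$ is either $0$ or an irreducible $S_M(V^0)$-module. -/

import Mathlib

open scoped DirectSum

noncomputable section

universe u v

/-- A vertex operator algebra `(V, Y, 𝟙, ω)` over `ℂ`. The field `Y u n` is the mode `u_n`, the
coefficient of `z ^ (-n-1)` in `Y(u, z)`. The Jacobi identity is given by its coefficients of
`z₀ ^ (-l-1) z₁ ^ (-m-1) z₂ ^ (-n-1)`; all sums over `i` in it are finite by `truncation`.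
The Virasoro modes are `L(n) = ω_{n+1}`, and the weight space `V_n` is the eigenspace of
`L(0) = ω_1` for the eigenvalue `n`. -/
structure VertexOperatorAlgebra (V : Type u) [AddCommGroup V] [Module ℂ V] where
  Y : V →ₗ[ℂ] ℤ → Module.End ℂ V
  vacuum : V
  conformal : V
  centralCharge : ℂ
  truncation : ∀ u v : V, ∃ N : ℤ, ∀ n : ℤ, N < n → Y u n v = 0
  vacuum_mode : ∀ n : ℤ, Y vacuum n = if n = -1 then 1 else 0
  creation : ∀ v : V, Y v (-1) vacuum = v
  creation_nonneg : ∀ (v : V) (n : ℤ), 0 ≤ n → Y v n vacuum = 0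
  jacobi : ∀ (u v w : V) (l m n : ℤ),
    ∑ᶠ i : ℕ, Ring.choose (m : ℂ) i • Y (Y u (l + i) v) (m + n - i) w =
      ∑ᶠ i : ℕ, ((-1) ^ i * Ring.choose (l : ℂ) i) •
        (Y u (m + l - i) (Y v (n + i) w) - (-1 : ℂ) ^ l • Y v (n + l - i) (Y u (m + i) w))
  virasoro : ∀ m n : ℤ,
    Y conformal (m + 1) * Y conformal (n + 1) - Y conformal (n + 1) * Y conformal (m + 1) =
      ((m : ℂ) - n) • Y conformal (m + n + 1) +
        (if m + n = 0 then ((m : ℂ) ^ 3 - m) / 12 * centralCharge else 0) • (1 : Module.End ℂ V)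
  derivative : ∀ (v : V) (n : ℤ), Y (Y conformal 0 v) n = -(n : ℂ) • Y v (n - 1)
  grading : DirectSum.IsInternal fun n : ℤ => Module.End.eigenspace (Y conformal 1) (n : ℂ)
  finite_weight : ∀ n : ℤ,
    FiniteDimensional ℂ (Module.End.eigenspace (Y conformal 1) (n : ℂ))
  bounded_weight : ∃ N : ℤ, ∀ n : ℤ, n < N →
    Module.End.eigenspace (Y conformal 1) (n : ℂ) = ⊥

namespace VertexOperatorAlgebra

variable {V : Type u} [AddCommGroup V] [Module ℂ V] (A : VertexOperatorAlgebra V)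

/-- The space `V_n` of vectors of weight `n`. -/
def weight (n : ℤ) : Submodule ℂ V := Module.End.eigenspace (A.Y A.conformal 1) (n : ℂ)

theorem mem_weight {n : ℤ} {v : V} : v ∈ A.weight n ↔ A.Y A.conformal 1 v = (n : ℂ) • v :=
  Module.End.mem_eigenspace_iff

theorem isInternal_weight : DirectSum.IsInternal A.weight := A.grading

theorem bijective_coeLinearMap : Function.Bijective (DirectSum.coeLinearMap A.weight) :=
  A.grading

/-- `V` is simple: it is irreducible as a module over itself. -/
def IsSimple : Prop :=
  Nontrivial V ∧ ∀ I : Submodule ℂ V, (∀ (u : V) (n : ℤ), ∀ x ∈ I, A.Y u n x ∈ I) →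
    I = ⊥ ∨ I = ⊤

/-- The decomposition of a vector into its homogeneous components. -/
def decompose : V ≃ₗ[ℂ] ⨁ n : ℤ, A.weight n :=
  (LinearEquiv.ofBijective (DirectSum.coeLinearMap A.weight) A.bijective_coeLinearMap).symm

theorem decompose_of_mem {n : ℤ} {v : V} (hv : v ∈ A.weight n) :
    A.decompose v = DirectSum.lof ℂ ℤ (fun n => A.weight n) n ⟨v, hv⟩ := by
  rw [decompose, LinearEquiv.symm_apply_eq, LinearEquiv.ofBijective_apply,
    DirectSum.coeLinearMap_lof]

/-- The linear map on `V` which on each `V_k` is the given `f k`. -/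
def homogeneousLift {W : Type*} [AddCommGroup W] [Module ℂ W] (f : ℤ → V →ₗ[ℂ] W) : V →ₗ[ℂ] W :=
  DirectSum.toModule ℂ ℤ W (fun k => f k ∘ₗ (A.weight k).subtype) ∘ₗ A.decompose.toLinearMap

theorem homogeneousLift_of_mem {W : Type*} [AddCommGroup W] [Module ℂ W] (f : ℤ → V →ₗ[ℂ] W)
    {k : ℤ} {v : V} (hv : v ∈ A.weight k) : A.homogeneousLift f v = f k v := by
  simp [homogeneousLift, A.decompose_of_mem hv, DirectSum.toModule_lof]

theorem homogeneous_induction {p : V → Prop} (h0 : p 0) (hadd : ∀ x y, p x → p y → p (x + y))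
    (hw : ∀ (k : ℤ) (x : V), x ∈ A.weight k → p x) (v : V) : p v := by
  have h : v ∈ ⨆ k, A.weight k := by
    rw [A.isInternal_weight.submodule_iSup_eq_top]; trivial
  exact Submodule.iSup_induction _ (motive := p) h hw h0 hadd

/-- The group of automorphisms of the vertex operator algebra. -/
def Aut : Subgroup (V ≃ₗ[ℂ] V) where
  carrier := {g | (∀ (u v : V) (n : ℤ), g (A.Y u n v) = A.Y (g u) n (g v)) ∧
    g A.vacuum = A.vacuum ∧ g A.conformal = A.conformal}
  mul_mem' := by
    rintro a b ⟨h1, h2, h3⟩ ⟨k1, k2, k3⟩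
    refine ⟨fun u v n => ?_, ?_, ?_⟩ <;> simp [*]
  one_mem' := by simp
  inv_mem' := by
    rintro a ⟨h1, h2, h3⟩
    have h (x : V) : a (a⁻¹ x) = x := LinearEquiv.apply_symm_apply a x
    refine ⟨fun u v n => a.injective ?_, a.injective ?_, a.injective ?_⟩ <;> simp [*]

variable {A}

theorem aut_map_mode (g : A.Aut) (u v : V) (n : ℤ) :
    (g : V ≃ₗ[ℂ] V) (A.Y u n v) = A.Y ((g : V ≃ₗ[ℂ] V) u) n ((g : V ≃ₗ[ℂ] V) v) :=
  g.2.1 u v n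

theorem aut_map_weight (g : A.Aut) {k : ℤ} {v : V} (hv : v ∈ A.weight k) :
    (g : V ≃ₗ[ℂ] V) v ∈ A.weight k := by
  rw [mem_weight] at hv ⊢
  have h := aut_map_mode g A.conformal v 1
  rw [g.2.2.2, hv, map_smul] at h
  exact h.symm

/-- For an automorphism `g` of order `T`, the space
`V^k = {v | g v = exp(-2πik/T) v}`. -/
def twistSpace (g : A.Aut) (T k : ℕ) : Submodule ℂ V :=
  Module.End.eigenspace ((g : V ≃ₗ[ℂ] V) : V →ₗ[ℂ] V)
    (Complex.exp (-2 * Real.pi * Complex.I * k / T))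

/-- The fixed-point subalgebra `V^0`. -/
abbrev fixedSpace (g : A.Aut) (T : ℕ) : Submodule ℂ V := twistSpace g T 0

theorem mem_fixedSpace {g : A.Aut} {T : ℕ} {v : V} :
    v ∈ fixedSpace g T ↔ (g : V ≃ₗ[ℂ] V) v = v := by
  simp [twistSpace]

variable (A)

theorem finite_support (a b : V) (c : ℕ → ℂ) (l : ℤ) (f : ℕ → V →ₗ[ℂ] V) :
    (Function.support fun i : ℕ => c i • f i (A.Y a (l + i) b)).Finite := by
  obtain ⟨N, hN⟩ := A.truncation a b
  refine (Set.finite_Iic (N - l).toNat).subset fun i hi => ?_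
  by_contra hlt
  simp only [Set.mem_Iic, not_le] at hlt
  exact hi (by simp [hN (l + i) (by omega)])

/-- The sum `∑ i, C(k - 1, i) a_i b`. -/
def weightBracket (k : ℤ) : V →ₗ[ℂ] V →ₗ[ℂ] V :=
  have hf (a b : V) : (Function.support fun i : ℕ =>
      Ring.choose ((k : ℂ) - 1) i • A.Y a i b).Finite := by
    simpa using A.finite_support a b (fun i => Ring.choose ((k : ℂ) - 1) i) 0 fun _ => 1
  LinearMap.mk₂ ℂ (fun a b => ∑ᶠ i : ℕ, Ring.choose ((k : ℂ) - 1) i • A.Y a i b)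
    (fun a a' b => by
      rw [← finsum_add_distrib (hf a b) (hf a' b)]
      simp)
    (fun c a b => by
      rw [smul_finsum]
      simp [smul_comm c])
    (fun a b b' => by
      rw [← finsum_add_distrib (hf a b) (hf a b')]
      simp)
    (fun c a b => by
      rw [smul_finsum]
      simp [smul_comm c])

theorem weightBracket_apply (k : ℤ) (a b : V) :
    A.weightBracket k a b = ∑ᶠ i : ℕ, Ring.choose ((k : ℂ) - 1) i • A.Y a i b := rfl

/-- The bilinear product on `V` with `[a, b] = ∑ i, C(wt a - 1, i) a_i b` for homogeneous `a`. -/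
def zeroBracket : V →ₗ[ℂ] V →ₗ[ℂ] V := A.homogeneousLift A.weightBracket

theorem zeroBracket_of_mem {k : ℤ} {a : V} (ha : a ∈ A.weight k) (b : V) :
    A.zeroBracket a b = ∑ᶠ i : ℕ, Ring.choose ((k : ℂ) - 1) i • A.Y a i b := by
  rw [zeroBracket, A.homogeneousLift_of_mem _ ha, weightBracket_apply]

theorem mode_mem_weight {r s : ℤ} {a b : V} (ha : a ∈ A.weight r) (hb : b ∈ A.weight s) (n : ℤ) :
    A.Y a n b ∈ A.weight (r + s - n - 1) := by
  have h := A.jacobi A.conformal a b 0 1 n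
  rw [mem_weight] at ha hb ⊢
  rw [finsum_eq_sum_of_support_subset (s := Finset.range 2), finsum_eq_single _ 0] at h
  · simp only [Finset.sum_range_succ, Finset.range_zero, Finset.sum_empty] at h
    simp only [Nat.cast_zero, Nat.cast_one, zero_add, add_zero, sub_zero, Int.cast_one,
      Ring.choose_zero_right, Ring.choose_one_right, one_smul, ha, A.derivative, pow_zero,
      zpow_zero, mul_one, hb, map_smul] at h
    rw [show (1 + n : ℤ) - 1 = n by ring] at h
    simp only [Pi.smul_apply, LinearMap.smul_apply, Int.cast_add, Int.cast_one] at h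
    rw [eq_sub_iff_add_eq] at h
    rw [← h]
    simp only [← add_smul]
    congr 1
    push_cast
    ring
  · intro i hi
    obtain ⟨j, rfl⟩ := Nat.exists_eq_succ_of_ne_zero hi
    simp [Ring.choose_zero_succ]
  · intro i hi
    by_contra h2
    apply hi
    have h2 : 1 < i := by simpa using h2
    have : Ring.choose ((1 : ℤ) : ℂ) i = 0 := by
      have := Ring.choose_natCast (R := ℂ) 1 i
      rw [Nat.choose_eq_zero_of_lt (by omega)] at this
      simpa using this
    simp only [this, zero_smul]

variable {A}

theorem aut_map_zeroBracket (g : A.Aut) (a b : V) :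
    (g : V ≃ₗ[ℂ] V) (A.zeroBracket a b) =
      A.zeroBracket ((g : V ≃ₗ[ℂ] V) a) ((g : V ≃ₗ[ℂ] V) b) := by
  refine A.homogeneous_induction (p := fun a => (g : V ≃ₗ[ℂ] V) (A.zeroBracket a b) =
    A.zeroBracket ((g : V ≃ₗ[ℂ] V) a) ((g : V ≃ₗ[ℂ] V) b)) ?_ ?_ ?_ a
  · simp
  · intro x y hx hy
    simp [hx, hy]
  · intro k x hx
    rw [A.zeroBracket_of_mem hx, A.zeroBracket_of_mem (aut_map_weight g hx)]
    have := AddMonoidHom.map_finsum ((g : V ≃ₗ[ℂ] V) : V →+ V)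
      (f := fun i : ℕ => Ring.choose ((k : ℂ) - 1) i • A.Y x i b) (by
        simpa [Function.HasFiniteSupport] using
          A.finite_support x b (fun i => Ring.choose ((k : ℂ) - 1) i) 0 fun _ => 1)
    simpa [aut_map_mode g] using this

theorem zeroBracket_mem (g : A.Aut) (T : ℕ) {a b : V} (ha : a ∈ fixedSpace g T)
    (hb : b ∈ fixedSpace g T) : A.zeroBracket a b ∈ fixedSpace g T := by
  rw [mem_fixedSpace] at *
  rw [aut_map_zeroBracket g, ha, hb]

theorem aut_map_component (g : A.Aut) (v : V) (k : ℤ) :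
    (g : V ≃ₗ[ℂ] V) (A.decompose v k) = A.decompose ((g : V ≃ₗ[ℂ] V) v) k := by
  refine A.homogeneous_induction (p := fun v => (g : V ≃ₗ[ℂ] V) (A.decompose v k) =
    A.decompose ((g : V ≃ₗ[ℂ] V) v) k) ?_ ?_ ?_ v
  · simp
  · intro x y hx hy
    simp [hx, hy]
  · intro j x hx
    rw [A.decompose_of_mem hx, A.decompose_of_mem (aut_map_weight g hx)]
    by_cases h : j = k
    · subst h
      simp [DirectSum.lof_apply]
    · simp [DirectSum.lof_eq_of, DirectSum.of_eq_of_ne _ _ _ (Ne.symm h)]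

theorem fixedSpace_induction (g : A.Aut) (T : ℕ) {p : V → Prop} (h0 : p 0)
    (hadd : ∀ x y, p x → p y → p (x + y))
    (hw : ∀ (k : ℤ) (x : V), x ∈ A.weight k → x ∈ fixedSpace g T → p x) (v : V)
    (hv : v ∈ fixedSpace g T) : p v := by
  classical
  have hsum : v = ∑ k ∈ DFinsupp.support (A.decompose v), (A.decompose v k : V) := by
    have := (LinearEquiv.ofBijective (DirectSum.coeLinearMap A.weight)
      A.bijective_coeLinearMap).apply_symm_apply v
    conv_lhs => rw [← this]
    rw [LinearEquiv.ofBijective_apply, DirectSum.coeLinearMap_eq_dfinsuppSum]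
    rfl
  rw [hsum]
  refine Finset.sum_induction _ p hadd h0 fun k _ => hw k _ (A.decompose v k).2 ?_
  rw [mem_fixedSpace] at *
  rw [aut_map_component g, hv]

end VertexOperatorAlgebra

open VertexOperatorAlgebra

/-- A weak `g`-twisted module over a vertex operator algebra, where `g` has order `T`. The field
`mode v n` is `v_n`, the coefficient of `z ^ (-n-1)` in `Y_M(v, z)`, for rational `n`. The twisted
Jacobi identity is given by its coefficients of `z₀ ^ (-l-1) z₁ ^ (-m-1) z₂ ^ (-n-1)`, where
`m ∈ r/T + ℤ` (the other powers of `z₁` do not occur). -/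
structure WeakTwistedModule {V : Type u} [AddCommGroup V] [Module ℂ V]
    (A : VertexOperatorAlgebra V) (g : A.Aut) (T : ℕ)
    (M : Type v) [AddCommGroup M] [Module ℂ M] where
  mode : V →ₗ[ℂ] ℚ → Module.End ℂ M
  mode_support : ∀ r < T, ∀ u ∈ twistSpace g T r, ∀ n : ℚ,
    (¬ ∃ k : ℤ, n = (r : ℚ) / T + k) → mode u n = 0
  truncation : ∀ (u : V) (w : M), ∃ N : ℚ, ∀ n : ℚ, N < n → mode u n w = 0
  vacuum_mode : ∀ n : ℚ, mode A.vacuum n = if n = -1 then 1 else 0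
  jacobi : ∀ r < T, ∀ u ∈ twistSpace g T r, ∀ (v : V) (w : M) (l : ℤ) (m n : ℚ),
    (∃ k : ℤ, m = (r : ℚ) / T + k) →
    ∑ᶠ i : ℕ, Ring.choose (m : ℂ) i • mode (A.Y u (l + i) v) (m + n - i) w =
      ∑ᶠ i : ℕ, ((-1) ^ i * Ring.choose (l : ℂ) i) •
        (mode u (m + l - i) (mode v (n + i) w) -
          (-1 : ℂ) ^ l • mode v (n + l - i) (mode u (m + i) w))

/-- An admissible `g`-twisted module `M = ⨁ n, M(n/T)`. The field `piece n` is `M(n/T)`; the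
supremum in `mode_mem` is the space `M(n/T + wt v - m - 1)`, which is zero unless the index is
`p/T` for a natural number `p`. That `M(0)` is nonzero is not included. -/
structure AdmissibleTwistedModule {V : Type u} [AddCommGroup V] [Module ℂ V]
    (A : VertexOperatorAlgebra V) (g : A.Aut) (T : ℕ)
    (M : Type v) [AddCommGroup M] [Module ℂ M] extends WeakTwistedModule A g T M where
  piece : ℕ → Submodule ℂ M
  isInternal : DirectSum.IsInternal piece
  mode_mem : ∀ (k : ℤ), ∀ v ∈ A.weight k, ∀ (m : ℚ) (n : ℕ), ∀ w ∈ piece n,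
    mode v m w ∈ ⨆ (p : ℕ) (_ : (p : ℚ) / T = (n : ℚ) / T + k - m - 1), piece p

/-- A twisted module is irreducible if it is nonzero and its only submodules are `0` and itself. -/
def WeakTwistedModule.IsIrreducible {V : Type u} [AddCommGroup V] [Module ℂ V]
    {A : VertexOperatorAlgebra V} {g : A.Aut} {T : ℕ}
    {M : Type v} [AddCommGroup M] [Module ℂ M] (X : WeakTwistedModule A g T M) : Prop :=
  Nontrivial M ∧ ∀ W : Submodule ℂ M, (∀ (u : V) (n : ℚ), ∀ w ∈ W, X.mode u n w ∈ W) →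
    W = ⊥ ∨ W = ⊤

namespace AdmissibleTwistedModule

variable {V : Type u} [AddCommGroup V] [Module ℂ V] {A : VertexOperatorAlgebra V} {g : A.Aut}
  {T : ℕ} {M : Type v} [AddCommGroup M] [Module ℂ M] (X : AdmissibleTwistedModule A g T M)

/-- The linear map `v ↦ o(v)`, with `o(v) = v_{wt v - 1}` on `M` for homogeneous `v`. -/
def zeroMode : V →ₗ[ℂ] Module.End ℂ M :=
  A.homogeneousLift fun k => LinearMap.proj ((k : ℚ) - 1) ∘ₗ X.mode

theorem zeroMode_of_mem {k : ℤ} {v : V} (hv : v ∈ A.weight k) :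
    X.zeroMode v = X.mode v ((k : ℚ) - 1) := by
  rw [zeroMode, A.homogeneousLift_of_mem _ hv]
  rfl

/-- The radical `J_M(V^0) = {v ∈ V^0 | o(v) = 0 on M}`. -/
def radical : Submodule ℂ (fixedSpace g T) :=
  LinearMap.ker (X.zeroMode ∘ₗ (fixedSpace g T).subtype)

/-- The Lie algebra `S_M(V^0) = V^0 / J_M(V^0)`. -/
def SM : Type u := fixedSpace g T ⧸ X.radical

instance : AddCommGroup X.SM := inferInstanceAs (AddCommGroup (fixedSpace g T ⧸ X.radical))

instance : Module ℂ X.SM := inferInstanceAs (Module ℂ (fixedSpace g T ⧸ X.radical))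

/-- The class in `S_M(V^0)` of an element of `V^0`. -/
def toSM : fixedSpace g T →ₗ[ℂ] X.SM := X.radical.mkQ

/-- The faithful action of `S_M(V^0)` on `M`, by `v ↦ o(v)`. -/
def rep : X.SM →ₗ[ℂ] Module.End ℂ M :=
  X.radical.liftQ (X.zeroMode ∘ₗ (fixedSpace g T).subtype) le_rfl

theorem rep_toSM (a : fixedSpace g T) : X.rep (X.toSM a) = X.zeroMode a := rfl

theorem toSM_surjective : Function.Surjective X.toSM := X.radical.mkQ_surjective

theorem rep_injective : Function.Injective X.rep := by
  rw [← LinearMap.ker_eq_bot]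
  exact Submodule.ker_liftQ_eq_bot' _ _ rfl

theorem zeroMode_mem [NeZero T] (v : V) {n : ℕ} {w : M} (hw : w ∈ X.piece n) :
    X.zeroMode v w ∈ X.piece n := by
  refine A.homogeneous_induction (p := fun v => X.zeroMode v w ∈ X.piece n) ?_ ?_ ?_ v
  · simp
  · intro x y hx hy
    simpa using add_mem hx hy
  · intro k x hx
    rw [X.zeroMode_of_mem hx]
    have h := X.mode_mem k x hx ((k : ℚ) - 1) n w hw
    have hT : (T : ℚ) ≠ 0 := by exact_mod_cast NeZero.ne T
    have hle : ⨆ (p : ℕ) (_ : (p : ℚ) / T = (n : ℚ) / T + k - ((k : ℚ) - 1) - 1), X.piece p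
        ≤ X.piece n := by
      refine iSup₂_le fun p hp => ?_
      have h1 : (p : ℚ) / T = (n : ℚ) / T := by rw [hp]; ring
      have h2 : p = n := by
        rw [div_left_inj' hT] at h1
        exact_mod_cast h1
      rw [h2]
    exact hle h

theorem zeroMode_zeroBracket [NeZero T] {a : V} (ha : a ∈ fixedSpace g T) (b : V) :
    X.zeroMode (A.zeroBracket a b) = ⁅X.zeroMode a, X.zeroMode b⁆ := by
  refine fixedSpace_induction g T (p := fun a => X.zeroMode (A.zeroBracket a b) =
    ⁅X.zeroMode a, X.zeroMode b⁆) ?_ ?_ ?_ a ha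
  · simp [LieRing.of_associative_ring_bracket]
  · intro x y hx hy
    simp only [map_add, LinearMap.add_apply, hx, hy, LieRing.of_associative_ring_bracket]
    noncomm_ring
  intro r a har ha
  refine A.homogeneous_induction (p := fun b => X.zeroMode (A.zeroBracket a b) =
    ⁅X.zeroMode a, X.zeroMode b⁆) ?_ ?_ ?_ b
  · simp [LieRing.of_associative_ring_bracket]
  · intro x y hx hy
    simp only [map_add, hx, hy, LieRing.of_associative_ring_bracket]
    noncomm_ring
  intro s b hb
  ext w
  have h := X.jacobi 0 (NeZero.pos T) a ha b w 0 ((r : ℚ) - 1) ((s : ℚ) - 1) ⟨r - 1, by simp⟩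
  rw [A.zeroBracket_of_mem har]
  have hfin : (Function.support fun i : ℕ => Ring.choose ((r : ℂ) - 1) i • A.Y a i b).Finite := by
    simpa using A.finite_support a b (fun i => Ring.choose ((r : ℂ) - 1) i) 0 fun _ => 1
  have hmap := AddMonoidHom.map_finsum
    (((LinearMap.applyₗ w : Module.End ℂ M →ₗ[ℂ] M) ∘ₗ X.zeroMode) : V →+ M) hfin
  simp only [LinearMap.comp_apply, LinearMap.applyₗ_apply_apply,
    AddMonoidHom.coe_coe] at hmap
  rw [hmap]
  rw [finsum_eq_single (fun i : ℕ => ((-1) ^ i * Ring.choose ((0 : ℤ) : ℂ) i) • _) 0] at h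
  · simp only [Int.cast_zero, Ring.choose_zero_right, pow_zero, mul_one, one_smul, zpow_zero,
      Nat.cast_zero, add_zero, sub_zero, zero_add] at h
    rw [X.zeroMode_of_mem har, X.zeroMode_of_mem hb, LieRing.of_associative_ring_bracket,
      LinearMap.sub_apply, Module.End.mul_apply, Module.End.mul_apply, ← h]
    refine finsum_congr fun i => ?_
    rw [map_smul, LinearMap.smul_apply, X.zeroMode_of_mem (A.mode_mem_weight har hb i)]
    push_cast
    congr 2
    exact congrArg _ (by ring)
  · intro i hi
    obtain ⟨j, rfl⟩ := Nat.exists_eq_succ_of_ne_zero hi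
    simp [Ring.choose_zero_succ]

/-- The bracket of `S_M(V^0)`, induced by `[a, b] = ∑ i, C(wt a - 1, i) a_i b`. -/
instance [NeZero T] : Bracket X.SM X.SM where
  bracket := Quotient.map₂
    (fun a b => ⟨A.zeroBracket a b, zeroBracket_mem g T a.2 b.2⟩) (by
      intro a a' haa b b' hbb
      have ha : X.zeroMode (a : V) = X.zeroMode (a' : V) :=
        congrArg X.rep (Quotient.sound haa : X.toSM a = X.toSM a')
      have hb : X.zeroMode (b : V) = X.zeroMode (b' : V) :=
        congrArg X.rep (Quotient.sound hbb : X.toSM b = X.toSM b')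
      apply Quotient.exact
      change X.toSM _ = X.toSM _
      apply X.rep_injective
      rw [rep_toSM, rep_toSM, X.zeroMode_zeroBracket a.2, X.zeroMode_zeroBracket a'.2, ha, hb])

theorem bracket_toSM [NeZero T] (a b : fixedSpace g T) : ⁅X.toSM a, X.toSM b⁆ =
    X.toSM ⟨A.zeroBracket a b, zeroBracket_mem g T a.2 b.2⟩ := rfl

theorem rep_bracket [NeZero T] (x y : X.SM) : X.rep ⁅x, y⁆ = ⁅X.rep x, X.rep y⁆ := by
  obtain ⟨a, rfl⟩ := X.toSM_surjective x
  obtain ⟨b, rfl⟩ := X.toSM_surjective y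
  rw [bracket_toSM, rep_toSM, rep_toSM, rep_toSM, X.zeroMode_zeroBracket a.2]

instance [NeZero T] : LieRing X.SM where
  add_lie x y z := X.rep_injective (by
    simp only [rep_bracket, map_add, LieRing.of_associative_ring_bracket]
    noncomm_ring)
  lie_add x y z := X.rep_injective (by
    simp only [rep_bracket, map_add, LieRing.of_associative_ring_bracket]
    noncomm_ring)
  lie_self x := X.rep_injective (by
    simp only [rep_bracket, map_zero, LieRing.of_associative_ring_bracket, sub_self])
  leibniz_lie x y z := X.rep_injective (by
    simp only [rep_bracket, map_add, LieRing.of_associative_ring_bracket]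
    noncomm_ring)

instance [NeZero T] : LieAlgebra ℂ X.SM where
  lie_smul c x y := X.rep_injective (by
    simp only [rep_bracket, map_smul, LieRing.of_associative_ring_bracket, mul_smul_comm,
      smul_mul_assoc, smul_sub])

/-- The action of `S_M(V^0)` on `M(n/T)`, by `v ↦ o(v)`. -/
instance [NeZero T] (n : ℕ) : LieRingModule X.SM (X.piece n) where
  bracket x w := ⟨X.rep x w, by
    obtain ⟨a, rfl⟩ := X.toSM_surjective x
    exact X.zeroMode_mem a w.2⟩
  add_lie x y w := Subtype.ext (by simp)
  lie_add x w w' := Subtype.ext (by simp)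
  leibniz_lie x y w := Subtype.ext (by simp [rep_bracket, LieRing.of_associative_ring_bracket])

theorem coe_bracket [NeZero T] (n : ℕ) (x : X.SM) (w : X.piece n) :
    ((⁅x, w⁆ : X.piece n) : M) = X.rep x w := rfl

instance [NeZero T] (n : ℕ) : LieModule ℂ X.SM (X.piece n) where
  smul_lie c x w := Subtype.ext (by simp [coe_bracket])
  lie_smul c x w := Subtype.ext (by simp [coe_bracket])

end AdmissibleTwistedModule

end

/-! Direct implication: if M is irreducible and x ≠ 0 lies in an S_M(V^0)-submodule N of M(n/T), the
span of all u_m x is a submodule (`mode_mem_span`), hence M. For u homogeneous in weight and under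
g, a nonzero u_m x has degree n/T only if m = wt u - 1, and this forces u ∈ V^0. So the degree-n/T
part of the span lies in N.

Converse: let W ≠ 0 be a submodule. By Dixmier's form of Schur's lemma, which needs only countable
dimension, L(0) is a scalar H n on each nonzero M(n/T) (`exists_virasoroMode_zero_eq_smul`). Nonzero
modes preserve H n - n/T, and any two nonzero components can be moved to a common one, so this
number is constant. Thus L(0) separates degrees, and W contains a nonzero homogeneous x.

From x, W meets every sufficiently high degree (`exists_forall_ge_mem_piece`). Every V^r is nonzero
because V is simple, so every residue class mod T is reached; some L(-m) goes far up, and L(-1) is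
injective there. By irreducibility W contains all high components. For homogeneous y, therefore,
L(-m)y ∈ W for all large m. The Virasoro relations then put every L(k)y in W
(`mem_of_virasoroMode_mem`). The vectors v with all v_q y ∈ W form an ideal of V; it contains ω ≠ 0,
so it contains the vacuum, and y ∈ W. -/

open VertexOperatorAlgebra

universe u v

/-! ### Linear algebra: eigenvector components and spectra in countable dimension. -/

section LinearAlgebra

variable {E : Type*} [AddCommGroup E] [Module ℂ E]

theorem Submodule.finsum_mem_of_forall (W : Submodule ℂ E) {f : ℕ → E} (h : ∀ i, f i ∈ W) :
    ∑ᶠ i, f i ∈ W :=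
  finsum_induction (· ∈ W) W.zero_mem (fun _ _ => W.add_mem) h

theorem Submodule.finsum_sub_zero_term_mem (W : Submodule ℂ E) {f : ℕ → E}
    (hf : (Function.support f).Finite) (h : ∀ i, i ≠ 0 → f i ∈ W) : ∑ᶠ i, f i - f 0 ∈ W := by
  classical
  rw [finsum_eq_sum_of_support_subset f (s := insert 0 hf.toFinset) (by simp),
    ← Finset.add_sum_erase _ f (Finset.mem_insert_self 0 _), add_sub_cancel_left]
  exact W.sum_mem fun i hi => h i (Finset.ne_of_mem_erase hi)

/-- Applying f - c_a removes the a-th term and multiplies the others by the nonzero numbers c_i -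
c_a, so induction applies. Used with f = L(0) to show that submodules contain homogeneous
components. -/
theorem Submodule.mem_of_sum_mem_of_eigenvector {ι : Type*} (W : Submodule ℂ E)
    (f : Module.End ℂ E) (hW : ∀ x ∈ W, f x ∈ W) (c : ι → ℂ) (s : Finset ι) :
    ∀ x : ι → E, (∀ i ∈ s, f (x i) = c i • x i) → Set.InjOn c s → ∑ i ∈ s, x i ∈ W →
      ∀ i ∈ s, x i ∈ W := by
  classical
  induction s using Finset.induction_on with
  | empty => simp
  | insert a s ha ih =>
    intro x hx hc hsum
    have key : ∀ i ∈ s, x i ∈ W := by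
      intro i hi
      have hmem : ∑ i ∈ s, (c i - c a) • x i ∈ W := by
        have h1 := W.sub_mem (hW _ hsum) (W.smul_mem (c a) hsum)
        rw [map_sum, Finset.smul_sum, ← Finset.sum_sub_distrib, Finset.sum_insert ha] at h1
        rw [hx a (Finset.mem_insert_self a s), sub_self, zero_add] at h1
        have h2 : ∑ i ∈ s, (c i - c a) • x i = ∑ i ∈ s, (f (x i) - c a • x i) :=
          Finset.sum_congr rfl fun j hj => by
            rw [hx j (Finset.mem_insert_of_mem hj), sub_smul]
        rwa [h2]
      have h2 := ih (fun i => (c i - c a) • x i)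
        (fun j hj => by
          rw [map_smul, hx j (Finset.mem_insert_of_mem hj), smul_comm])
        (hc.mono (by simp)) hmem i hi
      have hne : c i - c a ≠ 0 := sub_ne_zero.2 fun h => ha
        (hc (by simp [hi]) (by simp) h ▸ hi)
      exact (W.smul_mem_iff hne).1 h2
    intro i hi
    rcases Finset.mem_insert.1 hi with rfl | hi
    · rw [Finset.sum_insert ha] at hsum
      exact (W.add_mem_iff_left (W.sum_mem key)).1 hsum
    · exact key i hi

/-- An endomorphism of a complex vector space of countable dimension has a spectral value. -/
theorem Module.End.exists_not_isUnit_sub_of_rank_le [Nontrivial E]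
    (hE : Module.rank ℂ E ≤ Cardinal.aleph0) (f : Module.End ℂ E) :
    ∃ c : ℂ, ¬ IsUnit (f - algebraMap ℂ (Module.End ℂ E) c) := by
  classical
  by_contra! hf
  -- A nonzero p splits over ℂ, so p(f) is a nonzero scalar times a product of invertible factors f
  -- - a.
  have hinj : ∀ (p : Polynomial ℂ) (x : E), x ≠ 0 → Polynomial.aeval f p x = 0 → p = 0 := by
    intro p x hx hpx
    by_contra hp
    have hu : IsUnit (Polynomial.aeval f p) := by
      rw [(IsAlgClosed.splits p).eq_prod_roots, map_mul, Polynomial.aeval_C]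
      refine IsUnit.mul ((IsUnit.mk0 _ (by simpa using hp)).map _) ?_
      induction p.roots using Multiset.induction_on with
      | empty => simp
      | cons a s ih =>
        rw [Multiset.map_cons, Multiset.prod_cons, map_mul]
        exact IsUnit.mul (by simpa using hf a) ih
    have := (Module.End.isUnit_iff _).1 hu
    exact hx (this.1 (by rw [hpx, map_zero]))
  obtain ⟨x, hx⟩ := exists_ne (0 : E)
  have hsurj : ∀ c : ℂ, ∃ y, (f - algebraMap ℂ (Module.End ℂ E) c) y = x := fun c =>
    ((Module.End.isUnit_iff _).1 (hf c)).2 x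
  choose y hy using hsurj
  -- The vectors (f - c)⁻¹x are independent: clearing denominators turns a relation into a
  -- polynomial in f killing x, hence zero, and its value at i isolates the coefficient of y i.
  -- There are uncountably many of them.
  have hli : LinearIndependent ℂ y := by
    refine linearIndependent_iff'.2 fun s m hm i hi => ?_
    let q : Finset ℂ → Polynomial ℂ := fun t => ∏ j ∈ t, (Polynomial.X - Polynomial.C j)
    have h1 : ∀ c ∈ s, Polynomial.aeval f (q s) (y c) = Polynomial.aeval f (q (s.erase c)) x := by
      intro c hc
      simp only [q]
      rw [← Finset.prod_erase_mul _ _ hc, map_mul, Module.End.mul_apply, map_sub,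
        Polynomial.aeval_X, Polynomial.aeval_C, hy]
    have h2 : Polynomial.aeval f (∑ c ∈ s, Polynomial.C (m c) * q (s.erase c)) x = 0 := by
      have := congrArg (Polynomial.aeval f (q s)) hm
      rw [map_zero, map_sum] at this
      rw [map_sum, LinearMap.sum_apply, ← this]
      refine Finset.sum_congr rfl fun c hc => ?_
      rw [map_smul, h1 c hc, map_mul, Polynomial.aeval_C, Module.End.mul_apply,
        Module.algebraMap_end_apply]
    have h3 := congrArg (Polynomial.eval i) (hinj _ x hx h2)
    rw [Polynomial.eval_finsetSum, Finset.sum_eq_single i] at h3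
    · rw [Polynomial.eval_mul, Polynomial.eval_C, Polynomial.eval_zero] at h3
      refine (mul_eq_zero.1 h3).resolve_right ?_
      simp only [q, Polynomial.eval_prod]
      exact Finset.prod_ne_zero_iff.2 fun j hj => by
        simpa using sub_ne_zero.2 (Finset.ne_of_mem_erase hj).symm
    · intro j _ hji
      have : i ∈ s.erase j := Finset.mem_erase.2 ⟨hji.symm, hi⟩
      simp only [q, Polynomial.eval_mul, Polynomial.eval_prod]
      rw [Finset.prod_eq_zero this (by simp), mul_zero]
    · exact fun h => absurd hi h
  have h4 := hli.cardinal_lift_le_rank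
  have h5 : Cardinal.lift.{0} (Module.rank ℂ E) ≤ Cardinal.aleph0 := by simpa using hE
  have h6 := h4.trans h5
  rw [Cardinal.lift_le_aleph0, Cardinal.mk_complex] at h6
  exact absurd h6 (not_le.2 Cardinal.aleph0_lt_continuum)

end LinearAlgebra

/-! ### Annihilators in a simple vertex operator algebra. -/

namespace VertexOperatorAlgebra

variable {V : Type u} [AddCommGroup V] [Module ℂ V] {A : VertexOperatorAlgebra V}

/-- In a simple vertex operator algebra, `Y(u, z) w = 0` forces `u = 0` or `w = 0`. -/
theorem IsSimple.exists_mode_ne_zero (hA : A.IsSimple) {u w : V} (hu : u ≠ 0) (hw : w ≠ 0) :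
    ∃ n : ℤ, A.Y u n w ≠ 0 := by
  by_contra! hn
  -- The annihilator of w is an ideal. It contains u ≠ 0, so it would contain the vacuum, giving w =
  -- 0.
  let I : Submodule ℂ V :=
    { carrier := {v | ∀ n : ℤ, A.Y v n w = 0}
      add_mem' := fun {a b} ha hb n => by simp [ha n, hb n]
      zero_mem' := fun n => by simp
      smul_mem' := fun c a ha n => by simp [ha n] }
  have hI : ∀ (a : V) (n : ℤ), ∀ x ∈ I, A.Y a n x ∈ I := by
    intro a l x hx
    obtain ⟨N, hN⟩ := A.truncation a x
    obtain ⟨N', hN'⟩ := A.truncation a w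
    have key : ∀ (d : ℕ) (l : ℤ), N < l + d → A.Y a l x ∈ I := by
      intro d
      induction d with
      | zero =>
        intro l hl
        rw [hN l (by simpa using hl)]
        exact I.zero_mem
      | succ d ih =>
        intro l hl q
        -- Descending induction on l. With m = N' + 1 past the truncation bound of a on w, both
        -- products on the right vanish; on the left the terms i > 0 vanish by induction, leaving
        -- (a_l x)_q w.
        have h := A.jacobi a x w l (N' + 1) (q - (N' + 1))
        rw [finsum_eq_single _ 0] at h
        · have h0 : ∀ i : ℕ, A.Y a (N' + 1 + i) w = 0 := fun i => hN' _ (by omega)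
          simpa [hx _, h0] using h
        · intro i hi
          have h0 := ih (l + i) (by push_cast at hl; omega)
          rw [h0, smul_zero]
    exact key (N - l + 1).toNat l (by omega)
  rcases hA.2 I hI with h | h
  · exact hu ((Submodule.eq_bot_iff I).1 h u hn)
  · have h1 : A.vacuum ∈ I := h ▸ Submodule.mem_top
    have h2 := h1 (-1)
    rw [A.vacuum_mode] at h2
    exact hw (by simpa using h2)

/-! ### Eigenspaces of an automorphism of finite order, and countability of dimension. -/

theorem exp_neg_two_pi_mul_div (T r : ℕ) :
    Complex.exp (-2 * Real.pi * Complex.I * r / T) =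
      (Complex.exp (2 * Real.pi * Complex.I / T))⁻¹ ^ r := by
  rw [← Complex.exp_neg, ← Complex.exp_nat_mul]
  congr 1
  ring

theorem mem_twistSpace {g : A.Aut} {T r : ℕ} {v : V} : v ∈ twistSpace g T r ↔
    (g : V ≃ₗ[ℂ] V) v = (Complex.exp (2 * Real.pi * Complex.I / T))⁻¹ ^ r • v := by
  rw [twistSpace, Module.End.mem_eigenspace_iff, exp_neg_two_pi_mul_div]
  rfl

theorem mode_mem_twistSpace {g : A.Aut} {T r s : ℕ} {a b : V} (ha : a ∈ twistSpace g T r)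
    (hb : b ∈ twistSpace g T s) (n : ℤ) : A.Y a n b ∈ twistSpace g T (r + s) := by
  rw [mem_twistSpace] at *
  rw [aut_map_mode g, ha, hb, pow_add]
  simp [smul_smul, mul_comm]

theorem component_mem_twistSpace {g : A.Aut} {T r : ℕ} {v : V} (hv : v ∈ twistSpace g T r)
    (k : ℤ) : (A.decompose v k : V) ∈ twistSpace g T r := by
  rw [mem_twistSpace] at *
  rw [aut_map_component g, hv, map_smul]
  rfl

theorem eq_sum_component [DecidableEq V] (v : V) :
    v = ∑ k ∈ (A.decompose v).support, (A.decompose v k : V) := by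
  have := (LinearEquiv.ofBijective (DirectSum.coeLinearMap A.weight)
    A.bijective_coeLinearMap).apply_symm_apply v
  conv_lhs => rw [← this]
  rw [LinearEquiv.ofBijective_apply, DirectSum.coeLinearMap_eq_dfinsuppSum]
  unfold DFinsupp.sum
  exact Finset.sum_congr (by ext; simp [decompose]) fun _ _ => rfl

theorem exists_component_ne_zero {v : V} (hv : v ≠ 0) : ∃ k, (A.decompose v k : V) ≠ 0 := by
  by_contra! h
  refine hv (A.decompose.injective ?_)
  rw [map_zero]
  exact DFinsupp.ext fun k => Subtype.ext (h k)

theorem isPrimitiveRoot_exp_inv (T : ℕ) [NeZero T] :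
    IsPrimitiveRoot (Complex.exp (2 * Real.pi * Complex.I / T))⁻¹ T :=
  (Complex.isPrimitiveRoot_exp T (NeZero.ne T)).inv

theorem twistSpace_mod (g : A.Aut) (T : ℕ) [NeZero T] (r : ℕ) :
    twistSpace g T (r % T) = twistSpace g T r := by
  ext v
  rw [mem_twistSpace, mem_twistSpace, ← pow_mod_orderOf _ r,
    ← (isPrimitiveRoot_exp_inv T).eq_orderOf]

theorem aut_pow_apply (g : A.Aut) (n : ℕ) (v : V) :
    ((g ^ n : A.Aut) : V ≃ₗ[ℂ] V) v = (g : V ≃ₗ[ℂ] V)^[n] v := by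
  induction n generalizing v with
  | zero => simp
  | succ n ih => rw [pow_succ, Function.iterate_succ_apply, ← ih]; rfl

theorem iterate_apply_of_mem_twistSpace {g : A.Aut} {T r : ℕ} {v : V}
    (hv : v ∈ twistSpace g T r) (n : ℕ) : (g : V ≃ₗ[ℂ] V)^[n] v =
      ((Complex.exp (2 * Real.pi * Complex.I / T))⁻¹ ^ r) ^ n • v := by
  rw [mem_twistSpace] at hv
  induction n with
  | zero => simp
  | succ n ih => rw [Function.iterate_succ_apply', ih, map_smul, hv, smul_smul, pow_succ]

/-- `V` is spanned by the eigenspaces `V^r` of an automorphism of finite order. -/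
theorem iSup_twistSpace (g : A.Aut) (T : ℕ) [NeZero T] (hT : orderOf g = T) :
    ⨆ r ∈ Finset.range T, twistSpace g T r = ⊤ := by
  rw [eq_top_iff]
  intro v _
  set η : ℂ := (Complex.exp (2 * Real.pi * Complex.I / T))⁻¹ with hη
  have hηT : η ^ T = 1 := (isPrimitiveRoot_exp_inv T).pow_eq_one
  have hη0 : η ≠ 0 := by simp [hη]
  have hTC : (T : ℂ) ≠ 0 := Nat.cast_ne_zero.2 (NeZero.ne T)
  -- Discrete Fourier transform: summing over j projects v to V^r up to the factor T, and summing
  -- these over r gives T v.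
  let F : ℕ → ℕ → V := fun r j => (η⁻¹ ^ r) ^ j • (g : V ≃ₗ[ℂ] V)^[j] v
  have hF : ∀ r, F r T = F r 0 := by
    intro r
    have h1 : (g : V ≃ₗ[ℂ] V)^[T] v = v := by
      rw [← aut_pow_apply, ← hT, pow_orderOf_eq_one]
      rfl
    have h2 : (η⁻¹ ^ r) ^ T = 1 := by
      rw [← pow_mul, mul_comm, pow_mul, inv_pow, hηT, inv_one, one_pow]
    simp only [F, h1, h2, pow_zero, Function.iterate_zero, id]
  have hmem : ∀ r, ∑ j ∈ Finset.range T, F r j ∈ twistSpace g T r := by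
    intro r
    rw [mem_twistSpace, ← hη, map_sum, Finset.smul_sum]
    have h1 : ∑ j ∈ Finset.range T, η ^ r • F r (j + 1) = ∑ j ∈ Finset.range T, η ^ r • F r j := by
      have := (Finset.sum_range_succ (fun j => η ^ r • F r j) T).symm.trans
        (Finset.sum_range_succ' (fun j => η ^ r • F r j) T)
      rw [hF] at this
      exact (add_right_cancel this).symm
    rw [← h1]
    refine Finset.sum_congr rfl fun j _ => ?_
    simp only [F]
    rw [map_smul, Function.iterate_succ_apply', smul_smul]
    congr 1
    rw [pow_succ, mul_comm, mul_assoc, inv_pow, inv_mul_cancel₀ (pow_ne_zero r hη0), mul_one]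
  have hsum : ∑ r ∈ Finset.range T, ∑ j ∈ Finset.range T, F r j = (T : ℂ) • v := by
    rw [Finset.sum_comm, Finset.sum_eq_single 0]
    · simp [F, Nat.cast_smul_eq_nsmul]
    · intro j hj hj0
      simp only [F]
      rw [← Finset.sum_smul]
      have h1 : η⁻¹ ^ j ≠ 1 := by
        rw [inv_pow, Ne, inv_eq_one]
        exact (isPrimitiveRoot_exp_inv T).pow_ne_one_of_pos_of_lt hj0 (Finset.mem_range.1 hj)
      have h2 := geom_sum_mul (η⁻¹ ^ j) T
      rw [← pow_mul, mul_comm j, pow_mul, inv_pow η T, hηT, inv_one, one_pow, sub_self] at h2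
      have h3 := (mul_eq_zero.1 h2).resolve_right (sub_ne_zero.2 h1)
      rw [Finset.sum_congr rfl fun r _ => (pow_right_comm η⁻¹ r j), h3, zero_smul]
    · intro h
      exact absurd (Finset.mem_range.2 (NeZero.pos T)) h
  have hv : v = (T : ℂ)⁻¹ • ∑ r ∈ Finset.range T, ∑ j ∈ Finset.range T, F r j := by
    rw [hsum, smul_smul, inv_mul_cancel₀ hTC, one_smul]
  rw [hv]
  refine Submodule.smul_mem _ _ (Submodule.sum_mem _ fun r hr => ?_)
  exact Submodule.mem_iSup_of_mem r (Submodule.mem_iSup_of_mem hr (hmem r))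

theorem twistSpace_induction (g : A.Aut) (T : ℕ) [NeZero T] (hT : orderOf g = T)
    {p : V → Prop} (h0 : p 0) (hadd : ∀ x y, p x → p y → p (x + y))
    (hw : ∀ r < T, ∀ (k : ℤ), ∀ x ∈ twistSpace g T r, x ∈ A.weight k → p x) (v : V) : p v := by
  classical
  have h : v ∈ ⨆ r ∈ Finset.range T, twistSpace g T r := by
    rw [iSup_twistSpace g T hT]; trivial
  refine Submodule.iSup_induction _ (motive := p) h (fun r x hx => ?_) h0 hadd
  refine Submodule.iSup_induction _ (motive := p) hx (fun hr y hy => ?_) h0 hadd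
  rw [eq_sum_component (A := A) y]
  exact Finset.sum_induction _ p hadd h0 fun k _ =>
    hw r (Finset.mem_range.1 hr) k _ (component_mem_twistSpace hy k) (A.decompose y k).2

/-- For an automorphism of order `T` of a simple vertex operator algebra, all `V^r` are nonzero. -/
theorem IsSimple.exists_mem_twistSpace_weight (hA : A.IsSimple) (g : A.Aut) (T : ℕ) [NeZero T]
    (hT : orderOf g = T) (r : ℕ) :
    ∃ (k : ℤ) (v : V), v ≠ 0 ∧ v ∈ twistSpace g T r ∧ v ∈ A.weight k := by
  obtain ⟨x₀, hx₀⟩ := @exists_ne V hA.1 0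
  have hvac : A.vacuum ≠ 0 := fun h => hx₀ <| by
    have := A.vacuum_mode (-1)
    rw [h, map_zero, Pi.zero_apply, if_pos rfl] at this
    simpa using (LinearMap.congr_fun this x₀).symm
  -- The residues r with V^r ≠ 0 are closed under addition because Y(x, z)y ≠ 0 for nonzero x, y. In
  -- a finite group such a submonoid is a subgroup.
  let S : AddSubmonoid (ZMod T) :=
    { carrier := {a | twistSpace g T a.val ≠ ⊥}
      zero_mem' := by
        refine Submodule.ne_bot_iff _ |>.2 ⟨A.vacuum, ?_, hvac⟩
        rw [ZMod.val_zero, mem_fixedSpace]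
        exact g.2.2.1
      add_mem' := by
        intro a b ha hb
        obtain ⟨x, hx, hx0⟩ := (Submodule.ne_bot_iff _).1 ha
        obtain ⟨y, hy, hy0⟩ := (Submodule.ne_bot_iff _).1 hb
        obtain ⟨n, hn⟩ := hA.exists_mode_ne_zero hx0 hy0
        refine (Submodule.ne_bot_iff _).2 ⟨_, ?_, hn⟩
        rw [ZMod.val_add, twistSpace_mod]
        exact mode_mem_twistSpace hx hy n }
  let R : AddSubgroup (ZMod T) :=
    { S with
      neg_mem' := by
        intro a ha
        have h1 : -a = (addOrderOf a - 1) • a := by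
          have h2 := addOrderOf_nsmul_eq_zero a
          have h3 : addOrderOf a = (addOrderOf a - 1) + 1 :=
            (Nat.succ_pred_eq_of_pos (addOrderOf_pos a)).symm
          rw [h3, succ_nsmul] at h2
          exact (eq_neg_of_add_eq_zero_left h2).symm
        rw [h1]
        exact S.nsmul_mem ha _ }
  -- The order of R kills every s ∈ R, so g ^ |R| is trivial on each nonzero V^s. Hence T ≤ |R|,
  -- which makes R everything.
  have hd : g ^ Nat.card R = 1 := by
    apply Subtype.ext
    apply LinearEquiv.ext
    refine twistSpace_induction g T hT (by simp) (fun x y hx hy => ?_) ?_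
    · rw [map_add, hx, hy, map_add]
    intro s hs k x hx _
    by_cases hx0 : x = 0
    · simp [hx0]
    have hsR : (s : ZMod T) ∈ R := by
      refine (Submodule.ne_bot_iff _).2 ⟨x, ?_, hx0⟩
      rwa [ZMod.val_natCast, Nat.mod_eq_of_lt hs]
    have h1 : Nat.card R • (⟨(s : ZMod T), hsR⟩ : R) = 0 := card_nsmul_eq_zero'
    have h2 : T ∣ Nat.card R * s := by
      rw [← ZMod.natCast_eq_zero_iff]
      have h3 := congrArg Subtype.val h1
      rw [AddSubgroup.coe_nsmul, nsmul_eq_mul] at h3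
      rw [Nat.cast_mul]
      exact h3
    rw [aut_pow_apply, iterate_apply_of_mem_twistSpace hx, ← pow_mul, mul_comm s,
      ((isPrimitiveRoot_exp_inv T).pow_eq_one_iff_dvd _).2 h2, one_smul]
    rfl
  have hR : R = ⊤ := by
    refine AddSubgroup.eq_top_of_le_card _ ?_
    have h1 := Nat.le_of_dvd Nat.card_pos (orderOf_dvd_of_pow_eq_one hd)
    exact (Nat.card_zmod T).le.trans (hT.ge.trans h1)
  have hr : (r : ZMod T) ∈ R := hR ▸ AddSubgroup.mem_top _
  obtain ⟨x, hx, hx0⟩ := (Submodule.ne_bot_iff _).1 hr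
  rw [ZMod.val_natCast, twistSpace_mod] at hx
  obtain ⟨k, hk⟩ := exists_component_ne_zero (A := A) hx0
  exact ⟨k, _, hk, component_mem_twistSpace hx k, (A.decompose x k).2⟩

theorem rank_le_aleph0 (A : VertexOperatorAlgebra V) : Module.rank ℂ V ≤ Cardinal.aleph0 := by
  rw [A.decompose.rank_eq, rank_directSum]
  refine (Cardinal.sum_le_sum _ (fun _ => Cardinal.aleph0) fun n => ?_).trans ?_
  · have : FiniteDimensional ℂ (A.weight n) := A.finite_weight n
    exact (Module.rank_lt_aleph0 ℂ (A.weight n)).le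
  · simp

end VertexOperatorAlgebra

/-! ### Ideals and cyclic submodules attached to a vector of a twisted module. -/

namespace WeakTwistedModule

variable {V : Type u} [AddCommGroup V] [Module ℂ V] {A : VertexOperatorAlgebra V} {g : A.Aut}
  {T : ℕ} {M : Type v} [AddCommGroup M] [Module ℂ M] (X : WeakTwistedModule A g T M)

/-- Supplies the index m in r/T + ℤ at which one of the two products in the twisted Jacobi identity
disappears. -/
theorem exists_index_mode_eq_zero (u : V) (y : M) (r : ℕ) :
    ∃ k : ℤ, ∀ i : ℕ, X.mode u ((r : ℚ) / T + k + i) y = 0 := by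
  obtain ⟨N, hN⟩ := X.truncation u y
  refine ⟨⌊N⌋ + 1, fun i => hN _ ?_⟩
  have h1 : (0 : ℚ) ≤ (r : ℚ) / T := by positivity
  have h2 : (0 : ℚ) ≤ i := by positivity
  have h3 := Int.lt_floor_add_one N
  push_cast
  linarith

theorem finite_support_smul_mode (v : V) (y : M) (q : ℚ) (f : ℕ → Module.End ℂ M) :
    (Function.support fun i : ℕ => f i (X.mode v (q + i) y)).Finite := by
  obtain ⟨N, hN⟩ := X.truncation v y
  refine (Set.finite_Iic ⌈N - q⌉₊).subset fun i hi => ?_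
  by_contra hlt
  simp only [Set.mem_Iic, not_le] at hlt
  have h1 : N - q < i := (Nat.le_ceil _).trans_lt (by exact_mod_cast hlt)
  exact hi (by simp [hN (q + i) (by linarith)])

section Ideal

variable [NeZero T] (hT : orderOf g = T) (W : Submodule ℂ M)
  (hW : ∀ (u : V) (n : ℚ), ∀ w ∈ W, X.mode u n w ∈ W)

include hT hW

/-- If `Y_M(v, z) y` has coefficients in the submodule `W`, then so has `Y_M(a_l v, z) y`. -/
theorem mode_mode_mem (y : M) (a : V) {x : V} (hx : ∀ q, X.mode x q y ∈ W) (l : ℤ) (q : ℚ) :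
    X.mode (A.Y a l x) q y ∈ W := by
  refine twistSpace_induction g T hT (p := fun a => X.mode (A.Y a l x) q y ∈ W) ?_ ?_ ?_ a
  · simp
  · intro a b ha hb
    simpa using W.add_mem ha hb
  intro r hr _ a ha _
  obtain ⟨N, hN⟩ := A.truncation a x
  obtain ⟨k, hk⟩ := X.exists_index_mode_eq_zero a y r
  -- Descending induction on l from the truncation bound of a on x. The index m is chosen so that
  -- a_{m+i} y = 0; the remaining right side lies in W, and so do the left terms with i > 0.
  have key : ∀ (d : ℕ) (l : ℤ), N < l + d → ∀ q : ℚ, X.mode (A.Y a l x) q y ∈ W := by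
    intro d
    induction d with
    | zero =>
      intro l hl q
      rw [hN l (by simpa using hl)]
      simp
    | succ d ih =>
      intro l hl q
      have h := X.jacobi r hr a ha x y l ((r : ℚ) / T + k) (q - ((r : ℚ) / T + k)) ⟨k, rfl⟩
      have h1 : ∑ᶠ i : ℕ, ((-1) ^ i * Ring.choose (l : ℂ) i) •
        (X.mode a ((r : ℚ) / T + k + l - i) (X.mode x (q - ((r : ℚ) / T + k) + i) y) -
          (-1 : ℂ) ^ l • X.mode x (q - ((r : ℚ) / T + k) + l - i)
            (X.mode a ((r : ℚ) / T + k + i) y)) ∈ W := by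
        refine W.finsum_mem_of_forall fun i => W.smul_mem _ ?_
        rw [hk i, map_zero, smul_zero, sub_zero]
        exact hW _ _ _ (hx _)
      rw [← h] at h1
      have h2 := W.finsum_sub_zero_term_mem (f := fun i : ℕ =>
        Ring.choose (((r : ℚ) / T + k : ℚ) : ℂ) i •
          X.mode (A.Y a (l + i) x) ((r : ℚ) / T + k + (q - ((r : ℚ) / T + k)) - i) y) ?_ ?_
      · have h3 := (W.sub_mem_iff_right h1).1 h2
        simpa using h3
      · refine (Set.finite_Iic (N - l).toNat).subset fun i hi => ?_
        by_contra hlt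
        simp only [Set.mem_Iic, not_le] at hlt
        exact hi (by simp [hN (l + i) (by omega)])
      · intro i hi
        exact W.smul_mem _ (ih (l + i) (by push_cast at hl; omega) _)
  exact key (N - l + 1).toNat l (by omega) q

/-- The vectors v with this property form an ideal of V. If nonzero it contains the vacuum, whose
mode -1 is the identity. For W = ⊥ this says that a nonzero v does not annihilate a nonzero y. -/
theorem mem_of_forall_mode_mem (hA : A.IsSimple) {y : M} {v : V} (hv : v ≠ 0)
    (h : ∀ q, X.mode v q y ∈ W) : y ∈ W := by
  let I : Submodule ℂ V :=
    { carrier := {v | ∀ q, X.mode v q y ∈ W}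
      add_mem' := fun {a b} ha hb n => by simpa using W.add_mem (ha n) (hb n)
      zero_mem' := fun n => by simp
      smul_mem' := fun c a ha n => by simpa using W.smul_mem c (ha n) }
  rcases hA.2 I (fun a n x hx => X.mode_mode_mem hT W hW y a hx n) with hI | hI
  · exact absurd ((Submodule.eq_bot_iff I).1 hI v h) hv
  · have h1 : A.vacuum ∈ I := hI ▸ Submodule.mem_top
    have h2 := h1 (-1)
    rw [X.vacuum_mode] at h2
    simpa using h2

end Ideal

/-- The span of the vectors `u_m x` for fixed `x` is a submodule. -/
theorem mode_mem_span [NeZero T] (hT : orderOf g = T) (x : M) (u : V) (p : ℚ) {w : M}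
    (hw : w ∈ Submodule.span ℂ (Set.range fun a : V × ℚ => X.mode a.1 a.2 x)) :
    X.mode u p w ∈ Submodule.span ℂ (Set.range fun a : V × ℚ => X.mode a.1 a.2 x) := by
  set S := Submodule.span ℂ (Set.range fun a : V × ℚ => X.mode a.1 a.2 x) with hS
  have hmem : ∀ v q, X.mode v q x ∈ S := fun v q => Submodule.subset_span ⟨(v, q), rfl⟩
  refine twistSpace_induction g T hT (p := fun u => X.mode u p w ∈ S) ?_ ?_ ?_ u
  · simp
  · intro a b ha hb
    simpa using S.add_mem ha hb
  intro r hr _ u hu _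
  by_cases hp : ∃ k : ℤ, p = (r : ℚ) / T + k
  swap
  · rw [X.mode_support r hr u hu p hp]
    simp
  have hle : S ≤ S.comap (X.mode u p) := by
    refine Submodule.span_le.2 ?_
    rintro _ ⟨⟨v, q⟩, rfl⟩
    change X.mode u p (X.mode v q x) ∈ S
    obtain ⟨j, rfl⟩ := hp
    obtain ⟨N, hN⟩ := X.truncation v x
    obtain ⟨k, hk⟩ := X.exists_index_mode_eq_zero u x r
    -- Descending induction on q, with j free because the terms i > 0 of the Jacobi identity pair q
    -- + i with j - i. The left side of the identity consists of single modes applied to x.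
    have key : ∀ (d : ℕ) (q : ℚ), N < q + d → ∀ j : ℤ,
        X.mode u ((r : ℚ) / T + j) (X.mode v q x) ∈ S := by
      intro d
      induction d with
      | zero =>
        intro q hq j
        rw [hN q (by simpa using hq)]
        simp
      | succ d ih =>
        intro q hq j
        have h := X.jacobi r hr u hu v x (j - k) ((r : ℚ) / T + k) q ⟨k, rfl⟩
        simp only [hk, map_zero, smul_zero, sub_zero] at h
        have h1 := S.finsum_mem_of_forall (f := fun i : ℕ =>
          Ring.choose (((r : ℚ) / T + k : ℚ) : ℂ) i •
            X.mode (A.Y u (j - k + i) v) ((r : ℚ) / T + k + q - i) x)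
          fun i => S.smul_mem _ (hmem _ _)
        rw [h] at h1
        have h2 := S.finsum_sub_zero_term_mem (X.finite_support_smul_mode v x q fun i =>
          ((-1) ^ i * Ring.choose ((j - k : ℤ) : ℂ) i) •
            X.mode u ((r : ℚ) / T + k + (j - k : ℤ) - i)) ?_
        · have h3 := (S.sub_mem_iff_right h1).1 h2
          simpa using h3
        · intro i hi
          refine S.smul_mem _ ?_
          have h3 := ih (q + i) (by
            have : (1 : ℚ) ≤ i := by exact_mod_cast Nat.one_le_iff_ne_zero.2 hi
            push_cast at hq
            linarith) (j - i)
          convert h3 using 3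
          push_cast
          ring
    refine key (⌊N - q⌋₊ + 1) q ?_ j
    have := Nat.lt_floor_add_one (N - q)
    push_cast
    linarith
  exact hle hw

end WeakTwistedModule

/-! ### Virasoro operators on twisted modules. -/

theorem Complex.ringChoose_three (x : ℂ) :
    Ring.choose x 3 = x * (x - 1) * (x - 2) / 6 := by
  have h := Ring.descPochhammer_eq_factorial_smul_choose x 3
  have h2 : (2 : Polynomial ℤ).smeval x = 2 := by
    simpa using Polynomial.smeval_natCast (R := ℤ) x 2
  simp [descPochhammer_succ_right, Polynomial.smeval_mul, Polynomial.smeval_sub, Nat.factorial,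
    Polynomial.smeval_X, h2] at h
  linear_combination -h / 6

namespace VertexOperatorAlgebra

variable {V : Type u} [AddCommGroup V] [Module ℂ V] {A : VertexOperatorAlgebra V}

theorem conformal_mode_vacuum_neg_two (u : V) : A.Y A.conformal 0 u = A.Y u (-2) A.vacuum := by
  have h := LinearMap.congr_fun (A.derivative u (-1)) A.vacuum
  rw [A.creation] at h
  simpa using h

/-- Apply the relation for [L(i-1), L(-2)] to the vacuum, which ω_i kills for i ≥ 0. -/
theorem conformal_mode_conformal (i : ℕ) : A.Y A.conformal i A.conformal =
    ((i : ℂ) + 1) • A.Y A.conformal (i - 2) A.vacuum +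
      (if i = 3 then A.centralCharge / 2 else 0) • A.vacuum := by
  have h := LinearMap.congr_fun (A.virasoro (i - 1) (-2)) A.vacuum
  simp only [LinearMap.sub_apply, Module.End.mul_apply, sub_add_cancel] at h
  rw [A.creation_nonneg _ (i : ℤ) (by positivity), map_zero, sub_zero,
    show (-2 + 1 : ℤ) = -1 by norm_num, A.creation] at h
  rw [h]
  simp only [LinearMap.add_apply, LinearMap.smul_apply, Module.End.one_apply]
  congr 1
  · rw [show (i : ℤ) - 1 + -2 + 1 = i - 2 by ring]
    congr 1
    push_cast
    ring
  · congr 1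
    by_cases hi : i = 3
    · subst hi
      norm_num
      ring
    · rw [if_neg hi, if_neg (by omega)]

theorem conformal_mem_fixedSpace (g : A.Aut) (T : ℕ) : A.conformal ∈ fixedSpace g T := by
  rw [mem_fixedSpace]
  exact g.2.2.2

end VertexOperatorAlgebra

namespace WeakTwistedModule

variable {V : Type u} [AddCommGroup V] [Module ℂ V] {A : VertexOperatorAlgebra V} {g : A.Aut}
  {T : ℕ} {M : Type v} [AddCommGroup M] [Module ℂ M] (X : WeakTwistedModule A g T M)

/-- The commutator formula for `u ∈ V^0`. -/
theorem mode_commutator [NeZero T] {u : V} (hu : u ∈ fixedSpace g T) (v : V) (m : ℤ) (n : ℚ)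
    (w : M) : X.mode u m (X.mode v n w) - X.mode v n (X.mode u m w) =
      ∑ᶠ i : ℕ, Ring.choose (m : ℂ) i • X.mode (A.Y u i v) (m + n - i) w := by
  have h := X.jacobi 0 (NeZero.pos T) u hu v w 0 m n ⟨m, by simp⟩
  rw [finsum_eq_single (fun i : ℕ => ((-1) ^ i * Ring.choose ((0 : ℤ) : ℂ) i) • _) 0] at h
  · simpa using h.symm
  · intro i hi
    obtain ⟨j, rfl⟩ := Nat.exists_eq_succ_of_ne_zero hi
    simp [Ring.choose_zero_succ]

/-- The `L(-1)`-derivative property. -/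
theorem mode_derivative [NeZero T] (hT : orderOf g = T) (u : V) (q : ℚ) :
    X.mode (A.Y A.conformal 0 u) q = -(q : ℂ) • X.mode u (q - 1) := by
  refine twistSpace_induction g T hT
    (p := fun u => X.mode (A.Y A.conformal 0 u) q = -(q : ℂ) • X.mode u (q - 1)) ?_ ?_ ?_ u
  · simp
  · intro a b ha hb
    simp only [map_add, Pi.add_apply, ha, hb, smul_add]
  intro r hr _ u hu _
  by_cases hq : ∃ k : ℤ, q = (r : ℚ) / T + k
  · ext w
    -- With l = -2 and n = 0 only the vacuum modes of index ≥ 0 or ≤ -2 occur on the right, and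
    -- these vanish. The left side reduces to i = 0, 1, since u_i kills the vacuum for i ≥ 0.
    have h := X.jacobi r hr u hu A.vacuum w (-2) q 0 hq
    rw [finsum_eq_sum_of_support_subset (s := Finset.range 2), finsum_eq_zero_of_forall_eq_zero]
      at h
    · simp only [Finset.sum_range_succ, Finset.range_zero, Finset.sum_empty, Nat.cast_zero,
        Nat.cast_one, zero_add, add_zero, sub_zero, Ring.choose_zero_right,
        Ring.choose_one_right, one_smul, show (-2 + 1 : ℤ) = -1 by norm_num, A.creation,
        ← conformal_mode_vacuum_neg_two] at h
      rw [LinearMap.smul_apply, neg_smul]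
      exact eq_neg_of_add_eq_zero_left h
    · intro i
      have h1 : ¬ ((0 : ℚ) + i = -1) := by
        intro h
        have : (0 : ℚ) ≤ i := by positivity
        linarith
      have h2 : ¬ ((0 : ℚ) + (-2 : ℤ) - i = -1) := by
        intro h
        have : (0 : ℚ) ≤ i := by positivity
        push_cast at h
        linarith
      rw [X.vacuum_mode, X.vacuum_mode, if_neg h1, if_neg h2]
      simp
    · intro i hi
      by_contra h2
      have h3 : 1 < i := by simpa using h2
      exact hi (by simp [A.creation_nonneg u (-2 + i) (by omega)])
  · have h1 : A.Y A.conformal 0 u ∈ twistSpace g T r := by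
      simpa using mode_mem_twistSpace (conformal_mem_fixedSpace g T) hu 0
    rw [X.mode_support r hr _ h1 q hq, X.mode_support r hr u hu (q - 1), smul_zero]
    rintro ⟨k, hk⟩
    exact hq ⟨k + 1, by push_cast; linarith⟩

/-- The operator `L(n)` on a twisted module. -/
def virasoroMode (n : ℤ) : Module.End ℂ M := X.mode A.conformal ((n : ℚ) + 1)

/-- In the commutator with ω_1 only ω_0 v and ω_1 v = k v contribute; the derivative property
evaluates the first. -/
theorem virasoroMode_zero_mode [NeZero T] (hT : orderOf g = T) {v : V} {k : ℤ}
    (hv : v ∈ A.weight k) (q : ℚ) (w : M) :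
    X.virasoroMode 0 (X.mode v q w) =
      X.mode v q (X.virasoroMode 0 w) + ((k : ℂ) - q - 1) • X.mode v q w := by
  have h := X.mode_commutator (conformal_mem_fixedSpace g T) v 1 q w
  rw [finsum_eq_sum_of_support_subset (s := Finset.range 2)] at h
  · rw [A.mem_weight] at hv
    simp only [Finset.sum_range_succ, Finset.range_zero, Finset.sum_empty, Nat.cast_zero,
        Nat.cast_one, zero_add, sub_zero, Ring.choose_zero_right,
        Ring.choose_one_right, one_smul, hv, X.mode_derivative hT, map_smul, Int.cast_one,
        Pi.smul_apply, LinearMap.smul_apply, add_sub_cancel_left] at h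
    rw [sub_eq_iff_eq_add] at h
    unfold virasoroMode
    rw [Int.cast_zero, zero_add, h, add_comm, ← add_smul]
    congr 2
    push_cast
    ring
  · intro i hi
    by_contra h2
    have h3 : 1 < i := by simpa using h2
    have : Ring.choose ((1 : ℤ) : ℂ) i = 0 := by
      have := Ring.choose_natCast (R := ℂ) 1 i
      rw [Nat.choose_eq_zero_of_lt (by omega)] at this
      simpa using this
    exact hi (by dsimp only; rw [this, zero_smul])

/-- The Virasoro relations on a twisted module. -/
theorem virasoroMode_commutator [NeZero T] (hT : orderOf g = T) (m n : ℤ) (w : M) :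
    X.virasoroMode m (X.virasoroMode n w) - X.virasoroMode n (X.virasoroMode m w) =
      ((m : ℂ) - n) • X.virasoroMode (m + n) w +
        (if m + n = 0 then ((m : ℂ) ^ 3 - m) / 12 * A.centralCharge else 0) • w := by
  have h := X.mode_commutator (conformal_mem_fixedSpace g T) A.conformal (m + 1) (n + 1) w
  have e2 : A.Y A.conformal (0 : ℤ) A.vacuum = 0 := A.creation_nonneg _ _ le_rfl
  have c1 : A.Y A.conformal 1 A.conformal = (2 : ℂ) • A.conformal := by
    have := conformal_mode_conformal (A := A) 1
    norm_num at this
    rw [this, A.creation]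
  have c2 : A.Y A.conformal 2 A.conformal = 0 := by
    have := conformal_mode_conformal (A := A) 2
    norm_num at this
    rw [this, e2, smul_zero]
  have c3 : A.Y A.conformal 3 A.conformal = (A.centralCharge / 2) • A.vacuum := by
    have := conformal_mode_conformal (A := A) 3
    norm_num at this
    rw [this, A.creation_nonneg _ _ (by norm_num), smul_zero, zero_add]
  rw [finsum_eq_sum_of_support_subset (s := Finset.range 4)] at h
  · simp only [Finset.sum_range_succ, Finset.range_zero, Finset.sum_empty, Nat.cast_zero,
        Nat.cast_one, Nat.cast_ofNat, zero_add, sub_zero, Ring.choose_zero_right,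
        Ring.choose_one_right, one_smul, c1, c2, c3, X.mode_derivative hT, map_smul, map_zero,
        Complex.ringChoose_three, X.vacuum_mode,
        Pi.smul_apply, Pi.zero_apply, LinearMap.zero_apply, smul_zero,
        LinearMap.smul_apply, add_zero] at h
    unfold virasoroMode
    push_cast at h ⊢
    rw [h, show (m : ℚ) + 1 + (n + 1) - 1 = m + n + 1 by ring, smul_smul, ← add_smul, smul_smul]
    congr 1
    · congr 1
      ring
    · have hiff : ((m : ℚ) + 1 + (n + 1) - 3 = -1) ↔ m + n = 0 := by
        constructor
        · intro h
          have : ((m + n : ℤ) : ℚ) = 0 := by push_cast; linarith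
          exact_mod_cast this
        · intro h
          have : ((m + n : ℤ) : ℚ) = 0 := by exact_mod_cast h
          push_cast at this
          linarith
      by_cases hmn : m + n = 0
      · rw [if_pos (hiff.2 hmn), if_pos hmn, Module.End.one_apply]
        congr 1
        ring
      · rw [if_neg (fun h => hmn (hiff.1 h)), if_neg hmn]
        simp
  · intro i hi
    by_contra h2
    have h3 : 3 < i := by
      simp at h2
      omega
    refine hi ?_
    dsimp only
    rw [conformal_mode_conformal, if_neg (by omega), A.creation_nonneg _ _ (by omega)]
    simp

/-- If `L(-m) y` lies in a submodule `W` for all large `m`, then so does `y`. -/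
theorem mem_of_virasoroMode_mem [NeZero T] (hT : orderOf g = T) (hA : A.IsSimple)
    (hω : A.conformal ≠ 0) (W : Submodule ℂ M)
    (hW : ∀ (u : V) (n : ℚ), ∀ w ∈ W, X.mode u n w ∈ W) {y : M} {N : ℤ}
    (hy : ∀ m : ℤ, N ≤ m → X.virasoroMode (-m) y ∈ W) : y ∈ W := by
  refine X.mem_of_forall_mode_mem hT W hW hA hω ?_
  obtain ⟨N', hN'⟩ := X.truncation A.conformal y
  have hWL : ∀ n : ℤ, ∀ w ∈ W, X.virasoroMode n w ∈ W := fun n w hw => hW _ _ w hw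
  obtain ⟨K, hK⟩ : ∃ K : ℤ, ∀ m : ℤ, K ≤ m → X.virasoroMode m y = 0 :=
    ⟨⌈N'⌉, fun m hm => hN' _ (by
      have h1 := Int.le_ceil N'
      have h2 : (⌈N'⌉ : ℚ) ≤ m := by exact_mod_cast hm
      linarith)⟩
  -- Since L(m)y = 0, the commutator [L(m), L(k-m)]y equals L(m)L(k-m)y, which lies in W.
  have hcomm : ∀ m k : ℤ, K ≤ m → N ≤ m - k →
      ((2 * m : ℂ) - k) • X.virasoroMode k y +
        (if k = 0 then ((m : ℂ) ^ 3 - m) / 12 * A.centralCharge else 0) • y ∈ W := by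
    intro m k h1 h2
    have h := X.virasoroMode_commutator hT m (k - m) y
    rw [hK m h1, map_zero, sub_zero] at h
    have h3 := hWL m _ (hy (m - k) h2)
    rw [neg_sub, h, add_sub_cancel] at h3
    rwa [show (2 * m : ℂ) - k = (m : ℂ) - ((k - m : ℤ) : ℂ) by push_cast; ring]
  have hL : ∀ k : ℤ, X.virasoroMode k y ∈ W := by
    intro k
    obtain ⟨m, h1, h2, h3, h4⟩ : ∃ m : ℤ, K ≤ m ∧ N ≤ m - k ∧ k < m ∧ 1 < m :=
      ⟨max (max K (N + k)) (max (k + 1) 2), by omega, by omega, by omega, by omega⟩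
    have hm := hcomm m k h1 h2
    by_cases hk : k = 0
    · subst hk
      -- For k = 0 the central term is eliminated between m and m + 1. The surviving coefficient of
      -- L(0)y is m(m+1)(2m+1)/6, nonzero as m > 1.
      have hm' := hcomm (m + 1) 0 (by omega) (by omega)
      simp only [if_true, Int.cast_zero, sub_zero] at hm hm'
      have h5 := W.sub_mem (W.smul_mem ((((m + 1 : ℤ) : ℂ) ^ 3 - (m + 1 : ℤ)) / 12) hm)
        (W.smul_mem (((m : ℂ) ^ 3 - m) / 12) hm')
      have h8 : ∀ (a b c p q : ℂ) (x z : M), a • (p • x + (b * c) • z) - b • (q • x + (a * c) • z) =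
        (a * p - b * q) • x := fun a b c p q x z => by module
      rw [h8] at h5
      refine (W.smul_mem_iff ?_).1 h5
      have h6 : (((m * (m + 1) * (2 * m + 1) : ℤ)) : ℂ) ≠ 0 := by
        rw [Int.cast_ne_zero]
        positivity
      intro h7
      apply h6
      push_cast at h7 ⊢
      linear_combination 6 * h7
    · rw [if_neg hk, zero_smul, add_zero] at hm
      refine (W.smul_mem_iff ?_).1 hm
      have : ((2 * m - k : ℤ) : ℂ) ≠ 0 := by
        rw [Int.cast_ne_zero]
        omega
      exact_mod_cast this
  intro q
  by_cases hq : ∃ k : ℤ, q = ((0 : ℕ) : ℚ) / T + k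
  · obtain ⟨k, rfl⟩ := hq
    have := hL (k - 1)
    simpa [virasoroMode] using this
  · rw [X.mode_support 0 (NeZero.pos T) _ (conformal_mem_fixedSpace g T) q hq]
    simp

/-- Injectivity of `L(-1)` on vectors of large `L(0)`-weight. -/
theorem eq_zero_of_virasoroMode_neg_one_eq_zero [NeZero T] (hT : orderOf g = T) {w : M} {c : ℂ}
    (hc : X.virasoroMode 0 w = c • w) (hw : X.virasoroMode (-1) w = 0) (K : ℕ)
    (hK : (X.virasoroMode 1 ^ K) w = 0) (hcK : ∀ k < K, 2 * c ≠ k) : w = 0 := by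
  have h0 : ∀ k : ℕ, X.virasoroMode 0 ((X.virasoroMode 1 ^ k) w) =
      (c - k) • (X.virasoroMode 1 ^ k) w := by
    intro k
    induction k with
    | zero => simpa using hc
    | succ k ih =>
      have h := X.virasoroMode_commutator hT 0 1 ((X.virasoroMode 1 ^ k) w)
      rw [ih, map_smul] at h
      rw [pow_succ', Module.End.mul_apply, sub_eq_iff_eq_add.1 h]
      simp only [zero_add, one_ne_zero, if_false, zero_smul, add_zero, ← add_smul]
      congr 1
      push_cast
      ring
  have he : ∀ k : ℕ, X.virasoroMode 1 ((X.virasoroMode 1 ^ k) w) =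
      (X.virasoroMode 1 ^ (k + 1)) w := fun k => by rw [pow_succ', Module.End.mul_apply]
  -- The sl₂ computation for a vector killed by L(-1).
  have h1 : ∀ k : ℕ, X.virasoroMode (-1) ((X.virasoroMode 1 ^ (k + 1)) w) =
      (((k : ℂ) + 1) * (k - 2 * c)) • (X.virasoroMode 1 ^ k) w := by
    intro k
    induction k with
    | zero =>
      have h := X.virasoroMode_commutator hT 1 (-1) w
      rw [hw, map_zero, zero_sub, add_neg_cancel, hc, neg_eq_iff_eq_neg] at h
      simp only [zero_add, pow_one, pow_zero, Module.End.one_apply]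
      rw [h, if_pos rfl, smul_smul, ← add_smul, ← neg_smul]
      congr 1
      push_cast
      ring
    | succ k ih =>
      have h := X.virasoroMode_commutator hT 1 (-1) ((X.virasoroMode 1 ^ (k + 1)) w)
      rw [ih, map_smul, he, he, add_neg_cancel, h0, if_pos rfl] at h
      rw [← sub_sub_cancel ((((k : ℂ) + 1) * (k - 2 * c)) • (X.virasoroMode 1 ^ (k + 1)) w)
        (X.virasoroMode (-1) _), h, smul_smul, ← add_smul, ← sub_smul]
      congr 1
      push_cast
      ring
  -- Descend from L(1)^K w = 0: each factor (k+1)(k-2c) is nonzero, so L(1)^{k+1} w = 0 implies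
  -- L(1)^k w = 0.
  have h2 : ∀ d ≤ K, (X.virasoroMode 1 ^ (K - d)) w = 0 := by
    intro d
    induction d with
    | zero => simpa using hK
    | succ d ih =>
      intro hd
      have h3 := h1 (K - (d + 1))
      rw [show K - (d + 1) + 1 = K - d by omega, ih (by omega), map_zero] at h3
      refine (smul_eq_zero.1 h3.symm).resolve_left (mul_ne_zero ?_ ?_)
      · exact Nat.cast_add_one_ne_zero _
      · exact sub_ne_zero.2 (hcK _ (by omega)).symm
  simpa using h2 K le_rfl

end WeakTwistedModule

theorem VertexOperatorAlgebra.conformal_mem_weight {V : Type u} [AddCommGroup V] [Module ℂ V]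
    (A : VertexOperatorAlgebra V) : A.conformal ∈ A.weight 2 := by
  have := conformal_mode_conformal (A := A) 1
  norm_num at this
  rw [A.mem_weight, this, A.creation]
  norm_num

/-- A basis of V is countable and the mode indices are rational, so countably many vectors span. -/
theorem WeakTwistedModule.rank_span_mode_le {V : Type u} [AddCommGroup V] [Module ℂ V]
    {A : VertexOperatorAlgebra V} {g : A.Aut} {T : ℕ} {M : Type v} [AddCommGroup M] [Module ℂ M]
    (X : WeakTwistedModule A g T M) (x : M) :
    Module.rank ℂ (Submodule.span ℂ (Set.range fun a : V × ℚ => X.mode a.1 a.2 x)) ≤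
      Cardinal.aleph0 := by
  let b := Module.Basis.ofVectorSpace ℂ V
  have hc : Countable (Module.Basis.ofVectorSpaceIndex ℂ V) := by
    rw [← Cardinal.mk_le_aleph0_iff, b.mk_eq_rank'']
    exact A.rank_le_aleph0
  have hle : Submodule.span ℂ (Set.range fun a : V × ℚ => X.mode a.1 a.2 x) ≤
      Submodule.span ℂ (Set.range
        fun a : Module.Basis.ofVectorSpaceIndex ℂ V × ℚ => X.mode (b a.1) a.2 x) := by
    refine Submodule.span_le.2 ?_
    rintro _ ⟨⟨v, q⟩, rfl⟩
    let φ : V →ₗ[ℂ] M :=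
      (LinearMap.applyₗ x : Module.End ℂ M →ₗ[ℂ] M) ∘ₗ LinearMap.proj q ∘ₗ X.mode
    have h1 : Submodule.span ℂ (Set.range b) ≤ Submodule.comap φ (Submodule.span ℂ (Set.range
        fun a : Module.Basis.ofVectorSpaceIndex ℂ V × ℚ => X.mode (b a.1) a.2 x)) := by
      refine Submodule.span_le.2 ?_
      rintro _ ⟨i, rfl⟩
      exact Submodule.subset_span ⟨(i, q), rfl⟩
    rw [b.span_eq] at h1
    exact h1 (Submodule.mem_top (x := v))
  refine (Submodule.rank_mono hle).trans ((rank_span_le _).trans ?_)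
  exact Cardinal.le_aleph0_iff_set_countable.2 (Set.countable_range _)

/-! ### Degrees of modes on an admissible module. -/

namespace AdmissibleTwistedModule

variable {V : Type u} [AddCommGroup V] [Module ℂ V] {A : VertexOperatorAlgebra V} {g : A.Aut}
  {T : ℕ} {M : Type v} [AddCommGroup M] [Module ℂ M]
  (X : AdmissibleTwistedModule A g T M)

theorem zeroMode_mem_of_stable {W : Submodule ℂ M}
    (hW : ∀ (u : V) (n : ℚ), ∀ w ∈ W, X.mode u n w ∈ W) (v : V) {w : M} (hw : w ∈ W) :
    X.zeroMode v w ∈ W := by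
  refine A.homogeneous_induction (p := fun v => X.zeroMode v w ∈ W) ?_ ?_ ?_ v
  · simp
  · intro x y hx hy
    simpa using add_mem hx hy
  · intro k x hx
    rw [X.zeroMode_of_mem hx]
    exact hW _ _ _ hw

variable [NeZero T]

theorem exists_mode_mem_piece {k : ℤ} {v : V} (hv : v ∈ A.weight k) {q : ℚ} {n : ℕ} {w : M}
    (hw : w ∈ X.piece n) (h : X.mode v q w ≠ 0) :
    ∃ p : ℕ, (p : ℚ) / T = (n : ℚ) / T + k - q - 1 ∧ X.mode v q w ∈ X.piece p := by
  have hT : (T : ℚ) ≠ 0 := by exact_mod_cast NeZero.ne T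
  have hm := X.mode_mem k v hv q n w hw
  by_cases hp : ∃ p : ℕ, (p : ℚ) / T = (n : ℚ) / T + k - q - 1
  · obtain ⟨p, hp⟩ := hp
    refine ⟨p, hp, (?_ : ⨆ (p : ℕ) (_ : (p : ℚ) / T = (n : ℚ) / T + k - q - 1), X.piece p ≤
      X.piece p) hm⟩
    refine iSup₂_le fun p' hp' => ?_
    rw [← hp, div_left_inj' hT] at hp'
    rw [Nat.cast_injective hp']
  · have hle : ⨆ (p : ℕ) (_ : (p : ℚ) / T = (n : ℚ) / T + k - q - 1), X.piece p ≤ ⊥ :=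
      iSup₂_le fun p' hp' => absurd ⟨p', hp'⟩ hp
    exact absurd ((Submodule.mem_bot ℂ).1 (hle hm)) h

theorem exists_virasoroMode_mem_piece {m : ℤ} {n : ℕ} {w : M} (hw : w ∈ X.piece n)
    (h : X.virasoroMode m w ≠ 0) :
    ∃ p : ℕ, (p : ℤ) + m * T = n ∧ X.virasoroMode m w ∈ X.piece p := by
  obtain ⟨p, hp, hmem⟩ := X.exists_mode_mem_piece A.conformal_mem_weight hw h
  refine ⟨p, ?_, hmem⟩
  have hT : (T : ℚ) ≠ 0 := by exact_mod_cast NeZero.ne T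
  field_simp at hp
  have h1 : (p : ℚ) + m * T = n := by
    push_cast at hp
    linarith
  exact_mod_cast h1

theorem virasoroMode_neg_mem_piece (m : ℕ) {n : ℕ} {w : M} (hw : w ∈ X.piece n) :
    X.virasoroMode (-m) w ∈ X.piece (n + m * T) := by
  by_cases h : X.virasoroMode (-m) w = 0
  · rw [h]
    exact Submodule.zero_mem _
  · obtain ⟨p, hp, hmem⟩ := X.exists_virasoroMode_mem_piece hw h
    have : p = n + m * T := by
      zify
      linarith
    rwa [← this]

theorem virasoroMode_zero_mem_piece {n : ℕ} {w : M} (hw : w ∈ X.piece n) :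
    X.virasoroMode 0 w ∈ X.piece n := by
  simpa using X.virasoroMode_neg_mem_piece 0 hw

/-- Each L(1) lowers the index by T, and there are no negative indices. -/
theorem virasoroMode_one_pow_eq_zero {n : ℕ} {w : M} (hw : w ∈ X.piece n) {k : ℕ}
    (hk : n < k * T) : (X.virasoroMode 1 ^ k) w = 0 := by
  have key : ∀ k : ℕ, (X.virasoroMode 1 ^ k) w ≠ 0 →
      ∃ p : ℕ, p + k * T = n ∧ (X.virasoroMode 1 ^ k) w ∈ X.piece p := by
    intro k
    induction k with
    | zero => exact fun _ => ⟨n, by simp, hw⟩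
    | succ k ih =>
      intro h
      rw [pow_succ', Module.End.mul_apply] at h ⊢
      obtain ⟨p, hp, hmem⟩ := ih fun h0 => h (by rw [h0, map_zero])
      obtain ⟨p', hp', hmem'⟩ := X.exists_virasoroMode_mem_piece hmem h
      refine ⟨p', ?_, hmem'⟩
      zify at hp ⊢
      rw [← hp, ← hp']
      ring
  by_contra h
  obtain ⟨p, hp, -⟩ := key k h
  omega

/-! ### Homogeneous components as S_M(V^0)-modules: Schur's lemma and the direct implication. -/

theorem piece_le_of_stable {n : ℕ} (hn : LieModule.IsIrreducible ℂ X.SM (X.piece n))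
    {W : Submodule ℂ M} (hW : ∀ (u : V) (n : ℚ), ∀ w ∈ W, X.mode u n w ∈ W) {x : M}
    (hx : x ∈ X.piece n) (hxW : x ∈ W) (hx0 : x ≠ 0) : X.piece n ≤ W := by
  let N : LieSubmodule ℂ X.SM (X.piece n) :=
    { W.comap (X.piece n).subtype with
      lie_mem := by
        intro s w hw
        obtain ⟨a, rfl⟩ := X.toSM_surjective s
        exact X.zeroMode_mem_of_stable hW a hw }
  have hN : N = ⊤ := (IsSimpleOrder.eq_bot_or_eq_top N).resolve_left fun h => by
    have h1 : (⟨x, hx⟩ : X.piece n) ∈ N := hxW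
    rw [h, LieSubmodule.mem_bot] at h1
    exact hx0 (congrArg Subtype.val h1)
  intro y hy
  have h1 : (⟨y, hy⟩ : X.piece n) ∈ N := hN ▸ LieSubmodule.mem_top _
  exact h1

theorem virasoroMode_zero_zeroMode (hT : orderOf g = T) (v : V) (w : M) :
    X.virasoroMode 0 (X.zeroMode v w) = X.zeroMode v (X.virasoroMode 0 w) := by
  refine A.homogeneous_induction (p := fun v => X.virasoroMode 0 (X.zeroMode v w) =
    X.zeroMode v (X.virasoroMode 0 w)) ?_ ?_ ?_ v
  · simp
  · intro x y hx hy
    simp only [map_add, LinearMap.add_apply, hx, hy]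
  · intro k x hx
    rw [X.zeroMode_of_mem hx, X.virasoroMode_zero_mode hT hx]
    simp

/-- `L(0)` acts as a scalar on a homogeneous component that is an irreducible
`S_M(V^0)`-module. -/
theorem exists_virasoroMode_zero_eq_smul (hT : orderOf g = T) {n : ℕ}
    (hn : LieModule.IsIrreducible ℂ X.SM (X.piece n)) :
    ∃ c : ℂ, ∀ w ∈ X.piece n, X.virasoroMode 0 w = c • w := by
  have : Nontrivial (X.piece n) := LieModule.nontrivial_of_isIrreducible ℂ X.SM (X.piece n)
  obtain ⟨⟨x, hx⟩, hx0⟩ := exists_ne (0 : X.piece n)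
  -- By irreducibility the component lies in the submodule spanned by the modes of x, which has
  -- countable dimension.
  have hrank : Module.rank ℂ (X.piece n) ≤ Cardinal.aleph0 := by
    refine (Submodule.rank_mono ?_).trans (X.rank_span_mode_le x)
    refine X.piece_le_of_stable hn (fun u q w hw => X.mode_mem_span hT x u q hw) hx
      (Submodule.subset_span ⟨(A.vacuum, -1), ?_⟩) fun h => hx0 (Subtype.ext h)
    simp [X.vacuum_mode]
  let f : Module.End ℂ (X.piece n) :=
    (X.virasoroMode 0).restrict fun _ => X.virasoroMode_zero_mem_piece
  obtain ⟨c, hc⟩ := Module.End.exists_not_isUnit_sub_of_rank_le hrank f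
  set d := f - algebraMap ℂ (Module.End ℂ (X.piece n)) c with hd
  have hdf : ∀ (s : X.SM) (w : X.piece n), d ⁅s, w⁆ = ⁅s, d w⁆ := by
    intro s w
    have h1 : f ⁅s, w⁆ = ⁅s, f w⁆ := by
      obtain ⟨a, rfl⟩ := X.toSM_surjective s
      exact Subtype.ext (X.virasoroMode_zero_zeroMode hT a w)
    simp only [hd, LinearMap.sub_apply, Module.algebraMap_end_apply, h1, lie_sub, lie_smul]
  let K : LieSubmodule ℂ X.SM (X.piece n) :=
    { LinearMap.ker d with
      lie_mem := by
        intro s w hw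
        change d ⁅s, w⁆ = 0
        rw [hdf, show d w = 0 from hw, lie_zero] }
  let R : LieSubmodule ℂ X.SM (X.piece n) :=
    { LinearMap.range d with
      lie_mem := by
        rintro s _ ⟨w, rfl⟩
        exact ⟨⁅s, w⁆, hdf s w⟩ }
  -- Kernel and range of d are submodules, so d is zero or bijective; the choice of c excludes the
  -- latter.
  have hd0 : ∀ w, d w = 0 := by
    rcases IsSimpleOrder.eq_bot_or_eq_top K with hK | hK
    · rcases IsSimpleOrder.eq_bot_or_eq_top R with hR | hR
      · intro w
        have h1 : d w ∈ R := ⟨w, rfl⟩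
        rwa [hR, LieSubmodule.mem_bot] at h1
      · refine absurd ((Module.End.isUnit_iff d).2 ⟨?_, ?_⟩) hc
        · rw [← LinearMap.ker_eq_bot, Submodule.eq_bot_iff]
          intro w hw
          have h1 : w ∈ K := hw
          rwa [hK, LieSubmodule.mem_bot] at h1
        · intro w
          have h1 : w ∈ R := hR ▸ LieSubmodule.mem_top w
          exact h1
    · intro w
      have h1 : w ∈ K := hK ▸ LieSubmodule.mem_top w
      exact h1
  refine ⟨c, fun w hw => ?_⟩
  have h1 := congrArg Subtype.val (hd0 ⟨w, hw⟩)
  exact sub_eq_zero.1 h1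

theorem isIrreducible_piece (hT : orderOf g = T) (hX : X.IsIrreducible) {n : ℕ}
    (hn : X.piece n ≠ ⊥) : LieModule.IsIrreducible ℂ X.SM (X.piece n) := by
  have : Nontrivial (X.piece n) := Submodule.nontrivial_iff_ne_bot.2 hn
  refine LieModule.IsIrreducible.mk fun N hN => ?_
  obtain ⟨x, hxN, hx0⟩ : ∃ x ∈ N, x ≠ 0 := by
    by_contra! h
    exact hN ((LieSubmodule.eq_bot_iff N).2 h)
  set S := Submodule.span ℂ (Set.range fun a : V × ℚ => X.mode a.1 a.2 (x : M)) with hS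
  have hxS : (x : M) ∈ S := Submodule.subset_span ⟨(A.vacuum, -1), by simp [X.vacuum_mode]⟩
  have hStop : S = ⊤ := (hX.2 S fun u q w hw => X.mode_mem_span hT _ u q hw).resolve_left
    fun h => hx0 (Subtype.ext ((Submodule.eq_bot_iff S).1 h _ hxS))
  -- Q is N in degree n/T and everything in the other degrees. Once Q contains the span of the modes
  -- of x, it is all of M, which forces N to be the whole component.
  let Q : Submodule ℂ M :=
    N.toSubmodule.map (X.piece n).subtype ⊔ ⨆ (p : ℕ) (_ : p ≠ n), X.piece p
  have hSQ : S ≤ Q := by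
    refine Submodule.span_le.2 ?_
    rintro _ ⟨⟨v, q⟩, rfl⟩
    change X.mode v q (x : M) ∈ Q
    refine twistSpace_induction g T hT (p := fun v => X.mode v q (x : M) ∈ Q) ?_ ?_ ?_ v
    · simp
    · intro a b ha hb
      simpa using Q.add_mem ha hb
    intro r hr k v hv hvk
    by_cases h0 : X.mode v q (x : M) = 0
    · rw [h0]
      exact Q.zero_mem
    by_cases hq : q = (k : ℚ) - 1
    · refine Submodule.mem_sup_left ?_
      -- Degree-preserving modes have the integral index k - 1, while nonzero modes of v ∈ V^r have
      -- index in r/T + ℤ.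
      have hr0 : r = 0 := by
        by_contra hr0
        refine h0 ?_
        rw [X.mode_support r hr v hv q, LinearMap.zero_apply]
        rintro ⟨j, hj⟩
        have hT0 : (T : ℚ) ≠ 0 := by exact_mod_cast NeZero.ne T
        rw [hq] at hj
        field_simp at hj
        have h1 : (k - 1) * (T : ℤ) = r + T * j := by exact_mod_cast hj
        have h2 : (T : ℤ) ∣ r := ⟨k - 1 - j, by linarith⟩
        exact hr0 (Nat.eq_zero_of_dvd_of_lt (Int.natCast_dvd_natCast.1 h2) hr)
      subst hr0
      have h1 : ⁅X.toSM ⟨v, hv⟩, x⁆ ∈ N := N.lie_mem hxN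
      refine ⟨_, h1, ?_⟩
      rw [hq, ← X.zeroMode_of_mem hvk]
      rfl
    · refine Submodule.mem_sup_right ?_
      obtain ⟨p, hp, hmem⟩ := X.exists_mode_mem_piece hvk x.2 h0
      refine Submodule.mem_iSup_of_mem p (Submodule.mem_iSup_of_mem ?_ hmem)
      rintro rfl
      exact hq (by linarith)
  rw [eq_top_iff]
  intro y _
  have hyQ : (y : M) ∈ Q := hSQ (hStop ▸ Submodule.mem_top)
  obtain ⟨a, ⟨a', ha', rfl⟩, b, hb, hab⟩ := Submodule.mem_sup.1 hyQ
  have hdisj := X.isInternal.submodule_iSupIndep n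
  have hb0 : b = 0 := (Submodule.disjoint_def.1 hdisj) b
    (by
      rw [← eq_sub_iff_add_eq'] at hab
      rw [hab]
      exact Submodule.sub_mem _ y.2 a'.2) hb
  rw [hb0, add_zero] at hab
  rw [← Subtype.ext hab]
  exact ha'

/-! ### The converse: propagating a homogeneous vector through all degrees. -/

section Converse

variable (hA : A.IsSimple) (hω : A.conformal ≠ 0) (hT : orderOf g = T)
  {H : ℕ → ℂ} (hH : ∀ n, ∀ w ∈ X.piece n, X.virasoroMode 0 w = H n • w)
  (W : Submodule ℂ M) (hW : ∀ (u : V) (n : ℚ), ∀ w ∈ W, X.mode u n w ∈ W)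

include hT hH in
-- The mode v_q raises the L(0)-eigenvalue and the degree by the same amount wt v - q - 1; the image
-- must be nonzero for the eigenvalues to be compared.
theorem weight_sub_eq {k : ℤ} {v : V} (hv : v ∈ A.weight k) {q : ℚ} {n p : ℕ} {w : M}
    (hw : w ∈ X.piece n) (h : X.mode v q w ≠ 0) (hp : X.mode v q w ∈ X.piece p)
    (hpn : (p : ℚ) / T = (n : ℚ) / T + k - q - 1) :
    H p - (p : ℂ) / T = H n - (n : ℂ) / T := by
  have h1 := X.virasoroMode_zero_mode hT hv q w
  rw [hH _ _ hp, hH _ _ hw, map_smul, ← add_smul] at h1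
  have h2 := smul_left_injective ℂ h h1
  have h3 := congrArg (Rat.cast : ℚ → ℂ) hpn
  push_cast at h3
  rw [h2, h3]
  ring

include hA hT hH hW in
-- A nonzero homogeneous v ∈ V^r with r ≡ n - n₀ mod T has a nonzero mode on x, and all its modes
-- change the index by -r modulo T.
theorem exists_mem_piece_modEq {n : ℕ} {x : M} (hx : x ∈ X.piece n) (hxW : x ∈ W) (hx0 : x ≠ 0)
    (n₀ : ℕ) : ∃ (p : ℕ) (c : ℤ) (w : M), (p : ℤ) = n₀ + T * c ∧ w ∈ X.piece p ∧ w ∈ W ∧ w ≠ 0 ∧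
      H p - (p : ℂ) / T = H n - (n : ℂ) / T := by
  have hTpos : (0 : ℤ) < T := by exact_mod_cast NeZero.pos T
  have hT0 : (T : ℚ) ≠ 0 := by exact_mod_cast NeZero.ne T
  obtain ⟨r, hr⟩ := Int.eq_ofNat_of_zero_le (Int.emod_nonneg ((n : ℤ) - n₀) hTpos.ne')
  have hrT : r < T := by
    have := Int.emod_lt_of_pos ((n : ℤ) - n₀) hTpos
    omega
  obtain ⟨k, v, hv0, hvr, hvk⟩ := hA.exists_mem_twistSpace_weight g T hT r
  obtain ⟨q, hq⟩ : ∃ q, X.mode v q x ≠ 0 := by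
    by_contra! h
    refine hx0 ((Submodule.mem_bot ℂ).1
      (X.mem_of_forall_mode_mem hT ⊥ ?_ hA hv0 fun q => (Submodule.mem_bot ℂ).2 (h q)))
    intro u m w hw
    rw [(Submodule.mem_bot ℂ).1 hw, map_zero]
    exact Submodule.zero_mem _
  obtain ⟨j, hj⟩ : ∃ j : ℤ, q = (r : ℚ) / T + j := by
    by_contra h
    exact hq (by rw [X.mode_support r hrT v hvr q h, LinearMap.zero_apply])
  obtain ⟨p, hp, hmem⟩ := X.exists_mode_mem_piece hvk hx hq
  refine ⟨p, ((n : ℤ) - n₀) / T + k - j - 1, _, ?_, hmem, hW _ _ _ hxW, hq,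
    X.weight_sub_eq hT hH hvk hx hq hmem hp⟩
  have h1 := Int.emod_add_mul_ediv ((n : ℤ) - n₀) T
  rw [hr] at h1
  rw [hj] at hp
  field_simp at hp
  have h2 : (p : ℤ) = n + T * k - (r + T * j) - T := by
    have : (p : ℚ) = n + T * k - (r + T * j) - T := by linarith
    exact_mod_cast this
  rw [h2]
  linear_combination -h1

include hA hω hT hH hW in
-- After moving to the right residue class, one nonzero L(-m) jumps to a high degree. From there
-- L(-1) is injective and climbs through every later index of the class.
theorem exists_forall_ge_mem_piece {n : ℕ} {x : M} (hx : x ∈ X.piece n) (hxW : x ∈ W)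
    (hx0 : x ≠ 0) (n₀ : ℕ) : ∃ N : ℕ, ∀ (p : ℕ) (c : ℤ), N ≤ p → (p : ℤ) = n₀ + T * c →
      ∃ w ∈ X.piece p, w ∈ W ∧ w ≠ 0 ∧ H p - (p : ℂ) / T = H n - (n : ℂ) / T := by
  have hTpos : 0 < T := NeZero.pos T
  obtain ⟨p₀, c₀, w, hp₀, hwp, hwW, hw0, hHw⟩ := X.exists_mem_piece_modEq hA hT hH W hW hx hxW hx0 n₀
  set h := H n - (n : ℂ) / T with hh
  -- The eigenvalue in index p has real part Re h + p/T. If twice it equals some k ≤ p/T, then p ≤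
  -- -2T Re h; hence L(-1) is injective in index p ≥ B.
  obtain ⟨B, hB⟩ := exists_nat_gt (-(2 * T * h.re))
  obtain ⟨m, hm, hmw⟩ : ∃ m : ℕ, B ≤ m ∧ X.virasoroMode (-m) w ≠ 0 := by
    by_contra! hc
    refine hw0 ((Submodule.mem_bot ℂ).1
      (X.mem_of_virasoroMode_mem hT hA hω ⊥ ?_ (N := B) fun m hm => ?_))
    · intro u m w hw
      rw [(Submodule.mem_bot ℂ).1 hw, map_zero]
      exact Submodule.zero_mem _
    · lift m to ℕ using by omega
      exact (Submodule.mem_bot ℂ).2 (hc m (by exact_mod_cast hm))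
  have key : ∀ j : ℕ, ∃ w ∈ X.piece (p₀ + m * T + j * T), w ∈ W ∧ w ≠ 0 ∧
      H (p₀ + m * T + j * T) - ((p₀ + m * T + j * T : ℕ) : ℂ) / T = h := by
    have shift : ∀ (p m : ℕ) (w : M), w ∈ X.piece p → X.virasoroMode (-m) w ≠ 0 →
        H p - (p : ℂ) / T = h → H (p + m * T) - ((p + m * T : ℕ) : ℂ) / T = h := by
      intro p m w hw hw0 hp
      rw [← hp]
      refine X.weight_sub_eq hT hH A.conformal_mem_weight hw hw0
        (X.virasoroMode_neg_mem_piece m hw) ?_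
      have hT0 : (T : ℚ) ≠ 0 := by exact_mod_cast NeZero.ne T
      field_simp
      push_cast
      ring
    intro j
    induction j with
    | zero =>
      simp only [zero_mul, add_zero]
      exact ⟨_, X.virasoroMode_neg_mem_piece m hwp, hW _ _ _ hwW, hmw, shift _ _ _ hwp hmw hHw⟩
    | succ j ih =>
      obtain ⟨y, hyp, hyW, hy0, hHy⟩ := ih
      set p := p₀ + m * T + j * T with hp
      have hne : X.virasoroMode (-(1 : ℕ)) y ≠ 0 := by
        intro hL
        -- Here p / T is the floor, so one more application of L(1) gives a negative degree.
        refine hy0 (X.eq_zero_of_virasoroMode_neg_one_eq_zero hT (hH p y hyp) hL (p / T + 1)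
          (X.virasoroMode_one_pow_eq_zero hyp ?_) ?_)
        · exact Nat.lt_mul_of_div_lt (Nat.lt_succ_self _) hTpos
        · intro k hk hck
          have hkp : k * T ≤ p := (Nat.le_div_iff_mul_le hTpos).1 (Nat.lt_succ_iff.1 hk)
          have hBp : B ≤ p := by
            have : m * 1 ≤ m * T := Nat.mul_le_mul_left m hTpos
            omega
          have h1 := congrArg Complex.re hHy
          have h2 := congrArg Complex.re hck
          have h3 : ((p : ℂ) / T).re = (p : ℝ) / T := by
            rw [← Complex.ofReal_natCast, ← Complex.ofReal_natCast, ← Complex.ofReal_div,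
              Complex.ofReal_re]
          rw [Complex.sub_re, h3] at h1
          have h4 : 2 * (H p).re = k := by simpa using h2
          have hTR : (0 : ℝ) < T := by exact_mod_cast hTpos
          have h5 : (k : ℝ) * T ≤ p := by exact_mod_cast hkp
          have h6 : (B : ℝ) ≤ p := by exact_mod_cast hBp
          have h7 : (H p).re * T = h.re * T + p := by
            rw [← h1]
            field_simp
            ring
          rw [← h4] at h5
          nlinarith
      have hsucc : p₀ + m * T + (j + 1) * T = p + 1 * T := by rw [hp]; ring
      rw [hsucc]
      exact ⟨_, X.virasoroMode_neg_mem_piece 1 hyp, hW _ _ _ hyW, hne, shift p 1 y hyp hne hHy⟩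
  refine ⟨p₀ + m * T, fun p c hp hpc => ?_⟩
  have hdvd : T ∣ p - (p₀ + m * T) := by
    rw [← Int.natCast_dvd_natCast, Nat.cast_sub hp]
    refine ⟨c - c₀ - m, ?_⟩
    push_cast
    rw [hpc, hp₀]
    ring
  obtain ⟨j, hj⟩ := hdvd
  have hpj : p = p₀ + m * T + j * T := by
    rw [mul_comm j, ← hj]
    omega
  rw [hpj]
  exact key j

variable (hirr : ∀ n, X.piece n ≠ ⊥ → LieModule.IsIrreducible ℂ X.SM (X.piece n))

include hA hω hT hH hW hirr in
/-- A submodule containing a nonzero homogeneous vector is everything, if all homogeneous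
components are zero or irreducible. -/
theorem eq_top_of_mem_piece {n : ℕ} {x : M} (hx : x ∈ X.piece n) (hxW : x ∈ W) (hx0 : x ≠ 0) :
    W = ⊤ := by
  rw [eq_top_iff, ← X.isInternal.submodule_iSup_eq_top]
  refine iSup_le fun n₀ y hy => ?_
  obtain ⟨N, hN⟩ := X.exists_forall_ge_mem_piece hA hω hT hH W hW hx hxW hx0 n₀
  refine X.mem_of_virasoroMode_mem hT hA hω W hW (N := N) fun m hm => ?_
  lift m to ℕ using by omega
  obtain ⟨w, hwp, hwW, hw0, -⟩ := hN (n₀ + m * T) m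
    (by
      have : m * 1 ≤ m * T := Nat.mul_le_mul_left m (NeZero.pos T)
      omega)
    (by push_cast; ring)
  exact X.piece_le_of_stable (hirr _ ((Submodule.ne_bot_iff _).2 ⟨w, hwp, hw0⟩)) hW hwp hwW hw0
    (X.virasoroMode_neg_mem_piece m hy)

include hA hω hT hH in
-- Both components can be carried, inside M itself, to one common high index divisible by T, where
-- the invariants are compared.
theorem weight_sub_eq_of_ne_bot {n n' : ℕ} (hn : X.piece n ≠ ⊥) (hn' : X.piece n' ≠ ⊥) :
    H n - (n : ℂ) / T = H n' - (n' : ℂ) / T := by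
  obtain ⟨x, hx, hx0⟩ := (Submodule.ne_bot_iff _).1 hn
  obtain ⟨x', hx', hx0'⟩ := (Submodule.ne_bot_iff _).1 hn'
  obtain ⟨N, hN⟩ := X.exists_forall_ge_mem_piece hA hω hT hH ⊤ (fun _ _ _ _ => trivial) hx
    trivial hx0 0
  obtain ⟨N', hN'⟩ := X.exists_forall_ge_mem_piece hA hω hT hH ⊤ (fun _ _ _ _ => trivial) hx'
    trivial hx0' 0
  have hle : (N + N') * 1 ≤ (N + N') * T := Nat.mul_le_mul_left _ (NeZero.pos T)
  obtain ⟨-, -, -, -, h⟩ := hN ((N + N') * T) (N + N') (by omega) (by push_cast; ring)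
  obtain ⟨-, -, -, -, h'⟩ := hN' ((N + N') * T) (N + N') (by omega) (by push_cast; ring)
  rw [← h, ← h']

end Converse

end AdmissibleTwistedModule

theorem proposition5p3 {V : Type*} [AddCommGroup V] [Module ℂ V]
    (A : VertexOperatorAlgebra V) (hA : A.IsSimple) (hω : A.conformal ≠ 0)
    (g : A.Aut) (T : ℕ) [NeZero T] (hT : orderOf g = T)
    {M : Type*} [AddCommGroup M] [Module ℂ M] (X : AdmissibleTwistedModule A g T M)
    (h0 : X.piece 0 ≠ ⊥) :
    X.IsIrreducible ↔
      ∀ n : ℕ, X.piece n ≠ ⊥ → LieModule.IsIrreducible ℂ X.SM (X.piece n) := by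
  refine ⟨fun hX n hn => X.isIrreducible_piece hT hX hn, fun hirr => ⟨?_, fun W hW => ?_⟩⟩
  · obtain ⟨x, -, hx0⟩ := (Submodule.ne_bot_iff _).1 h0
    exact ⟨x, 0, hx0⟩
  refine or_iff_not_imp_left.2 fun hWbot => ?_
  have hscalar : ∀ n, ∃ c : ℂ, ∀ w ∈ X.piece n, X.virasoroMode 0 w = c • w := by
    intro n
    by_cases hn : X.piece n = ⊥
    · refine ⟨0, fun w hw => ?_⟩
      rw [hn, Submodule.mem_bot] at hw
      rw [hw, map_zero, smul_zero]
    · exact X.exists_virasoroMode_zero_eq_smul hT (hirr n hn)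
  choose H hH using hscalar
  obtain ⟨w, hwW, hw0⟩ := (Submodule.ne_bot_iff _).1 hWbot
  have hwtop : w ∈ ⨆ n, X.piece n := by
    rw [X.isInternal.submodule_iSup_eq_top]
    trivial
  obtain ⟨f, hf, rfl⟩ := (Submodule.mem_iSup_iff_exists_finsupp _ _).1 hwtop
  have hne : f.support.Nonempty := by
    rw [Finsupp.support_nonempty_iff]
    rintro rfl
    exact hw0 Finsupp.sum_zero_index
  obtain ⟨n, hn⟩ := hne
  have hbot : ∀ i ∈ f.support, X.piece i ≠ ⊥ := fun i hi =>
    (Submodule.ne_bot_iff _).2 ⟨f i, hf i, Finsupp.mem_support_iff.1 hi⟩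
  -- As H i - i/T is constant on nonzero components, distinct degrees have distinct
  -- L(0)-eigenvalues, so W contains the homogeneous components of its vectors.
  have hfn := W.mem_of_sum_mem_of_eigenvector (X.virasoroMode 0) (fun x hx => hW _ _ x hx) H
    f.support f (fun i _ => hH i _ (hf i)) (fun i hi j hj hij => by
      have h1 := X.weight_sub_eq_of_ne_bot hA hω hT hH (hbot i hi) (hbot j hj)
      rw [hij, sub_right_inj, div_left_inj' (Nat.cast_ne_zero.2 (NeZero.ne T))] at h1
      exact_mod_cast h1) hwW n hn
  exact X.eq_top_of_mem_piece hA hω hT hH W hW hirr (hf n) hfn (Finsupp.mem_support_iff.1 hn)
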